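/- Let $\mathbb K$ be $\mathbb R$ or $\mathbb C$. Let $w=(w_i)_{i\ge 1}$ be an admissible sequence, that is, a decreasing sequence of nonnegative real numbers with $w_1=1$, $\lim_i w_i=0$ and $\sum_i w_i=\infty$, and put $W(n)=\sum_{i=1}^n w_i$. For a bounded sequence $x$ of scalars let $x^*=(x^*(i))_{i\ge1}$ be the decreasing rearrangement of $(|x(i)|)_{i\ge1}$. Let $d_*(w,1)$ be the Banach space of all bounded sequences $x$ in $\mathbb K$ with $\lim_{n\to\infty}\frac{1}{W(n)}\sum_{i=1}^n x^*(i)=0$, with the norm $\|x\|_W=\sup_{n\ge1}\frac{1}{W(n)}\sum_{i=1}^n x^*(i)$ (the predual of the Lorentz sequence space $d(w,1)$), and let $c_0$ be the space of null sequences in $\mathbb K$ with the supremum norm. For Banach spaces $X,Y$ over $\mathbb K$, let $\mathcal P(^N X;Y)$ be the space of continuous $N$-homogeneous polynomials, i.e. of the maps $x\mapsto\Phi(x,\dots,x)$ with $\Phi:X^N\to Y$ continuous and $N$-linear, and let $\mathcal P_N(X;Y)$ be the space of continuous polynomials of degree at most $N$, i.e. of the sums $P_0+\dots+P_N$ with $P_j\in\mathcal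 P(^jX;Y)$. Both carry the norm $\|P\|=\sup_{\|x\|\le1}\|P(x)\|$. Let $NA\mathcal P(^NX;Y)$ and $NA\mathcal P_N(X;Y)$ be the subsets of norm attaining elements, i.e. of those $P$ for which $\|P(x_0)\|=\|P\|$ for some $x_0$ with $\|x_0\|\le1$. Let $N\ge2$. Then: (i) $NA\mathcal P(^Nd_*(w,1);c_0)$ is dense in $\mathcal P(^Nd_*(w,1);c_0)$ if and only if $w\notin\ell_N$. (ii) $NA\mathcal P_N(d_*(w,1);c_0)$ is dense in $\mathcal P_N(d_*(w,1);c_0)$ if and only if $w\notin\ell_N$. -/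

import Mathlib

open Filter Topology
open scoped ZeroAtInfty

/-! ## Admissible sequences and the space `d_*(w,1)` -/

/-- An admissible sequence: a decreasing sequence `w` of nonnegative reals with first term `1`,
tending to `0` and with divergent sum. Sequences are indexed by `ℕ`, starting at `0`. -/
structure AdmissibleSequence where
  /-- The underlying sequence. -/
  toFun : ℕ → ℝ
  antitone : Antitone toFun
  nonneg : ∀ i, 0 ≤ toFun i
  zero_eq_one : toFun 0 = 1
  tendsto_zero : Tendsto toFun atTop (𝓝 0)
  not_summable : ¬ Summable toFun

/-- The partial sums `W(n)`, the sum of the first `n` terms of `w`. -/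
noncomputable def AdmissibleSequence.W (w : AdmissibleSequence) (n : ℕ) : ℝ :=
  ∑ i ∈ Finset.range n, w.toFun i

theorem AdmissibleSequence.one_le_W (w : AdmissibleSequence) (n : ℕ) : 1 ≤ w.W (n + 1) := by
  have h := Finset.single_le_sum (f := w.toFun) (s := Finset.range (n + 1))
    (fun i _ => w.nonneg i) (Finset.mem_range.2 (Nat.succ_pos n))
  rw [w.zero_eq_one] at h
  exact h

section Rearrangement

variable {𝕜 : Type*} [RCLike 𝕜]

/-- A bounded scalar sequence. -/
def IsBddSeq (x : ℕ → 𝕜) : Prop := ∃ C : ℝ, ∀ i, ‖x i‖ ≤ C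

/-- The decreasing rearrangement `x^*` of a bounded scalar sequence `x`: `x^*(n)` is the infimum of
those `t ≥ 0` for which at most `n` terms of `x` have modulus greater than `t` (`n` starts at `0`,
so that `x^*(0)` is the supremum of the moduli). -/
noncomputable def decRearr (x : ℕ → 𝕜) (n : ℕ) : ℝ :=
  sInf {t : ℝ | 0 ≤ t ∧ {i | t < ‖x i‖}.encard ≤ n}

/-- The sum of the first `n` terms of the decreasing rearrangement. -/
noncomputable def rearrSum (x : ℕ → 𝕜) (n : ℕ) : ℝ := ∑ i ∈ Finset.range n, decRearr x i

theorem decRearr_nonneg (x : ℕ → 𝕜) (n : ℕ) : 0 ≤ decRearr x n :=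
  Real.sInf_nonneg fun _ ht => ht.1

theorem rearrSum_nonneg (x : ℕ → 𝕜) (n : ℕ) : 0 ≤ rearrSum x n :=
  Finset.sum_nonneg fun i _ => decRearr_nonneg x i

theorem sum_le_rearrSum {x : ℕ → 𝕜} (hx : IsBddSeq x) (n : ℕ) :
    ∀ A : Finset ℕ, A.card = n → ∑ i ∈ A, ‖x i‖ ≤ rearrSum x n := by
  induction n with
  | zero =>
    intro A hA
    rw [Finset.card_eq_zero] at hA
    simp [hA, rearrSum]
  | succ n ih =>
    intro A hA
    have hne : A.Nonempty := by
      rw [← Finset.card_pos]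
      omega
    obtain ⟨a, haA, hmin⟩ := A.exists_min_image (fun i => ‖x i‖) hne
    have h1 := ih (A.erase a) (by rw [Finset.card_erase_of_mem haA]; omega)
    have h2 : ‖x a‖ ≤ decRearr x n := by
      obtain ⟨C, hC⟩ := hx
      refine le_csInf ⟨max C 0, le_max_right _ _, ?_⟩ ?_
      · have : {i | max C 0 < ‖x i‖} = ∅ := by
          ext i
          simp only [Set.mem_ofPred_eq, Set.mem_empty_iff_false, iff_false, not_lt]
          exact (hC i).trans (le_max_left _ _)
        rw [this]
        simp
      · rintro t ⟨_, ht⟩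
        by_contra hlt
        push Not at hlt
        have hsub : (A : Set ℕ) ⊆ {i | t < ‖x i‖} := fun i hi => hlt.trans_le (hmin i hi)
        have h3 := (Set.encard_le_encard hsub).trans ht
        rw [Set.encard_coe_eq_coe_finsetCard, hA] at h3
        have h4 : n + 1 ≤ n := by exact_mod_cast h3
        omega
    rw [← Finset.add_sum_erase A (fun i => ‖x i‖) haA]
    have h5 : rearrSum x (n + 1) = rearrSum x n + decRearr x n := Finset.sum_range_succ _ _
    linarith

theorem exists_rearrSum_le (x : ℕ → 𝕜) {ε : ℝ} (hε : 0 < ε) (n : ℕ) :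
    ∃ A : Finset ℕ, A.card = n ∧ rearrSum x n ≤ ∑ i ∈ A, ‖x i‖ + n * ε := by
  induction n with
  | zero => exact ⟨∅, rfl, by simp [rearrSum]⟩
  | succ n ih =>
    obtain ⟨A, hA, hle⟩ := ih
    have key : ∃ i, i ∉ A ∧ decRearr x n - ε ≤ ‖x i‖ := by
      by_cases ht : 0 ≤ decRearr x n - ε
      · have hnot : ¬ ({i | decRearr x n - ε < ‖x i‖}.encard ≤ n) := by
          intro h
          have : decRearr x n ≤ decRearr x n - ε :=
            csInf_le ⟨0, fun _ hs => hs.1⟩ ⟨ht, h⟩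
          linarith
        by_contra hcon
        push Not at hcon
        apply hnot
        have hsub : {i | decRearr x n - ε < ‖x i‖} ⊆ (A : Set ℕ) := by
          intro i hi
          by_contra hiA
          exact absurd (hcon i hiA) (not_lt.2 (le_of_lt hi))
        have h3 := Set.encard_le_encard hsub
        rwa [Set.encard_coe_eq_coe_finsetCard, hA] at h3
      · obtain ⟨i, hi⟩ := Infinite.exists_notMem_finset A
        exact ⟨i, hi, (le_of_not_ge ht).trans (norm_nonneg _)⟩
    obtain ⟨i, hi, hxi⟩ := key
    refine ⟨insert i A, by rw [Finset.card_insert_of_notMem hi, hA], ?_⟩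
    have h5 : rearrSum x (n + 1) = rearrSum x n + decRearr x n := Finset.sum_range_succ _ _
    rw [Finset.sum_insert hi, h5]
    push_cast
    linarith

theorem rearrSum_le_of_forall {x : ℕ → 𝕜} {n : ℕ} {C : ℝ}
    (h : ∀ A : Finset ℕ, A.card = n → ∑ i ∈ A, ‖x i‖ ≤ C) : rearrSum x n ≤ C := by
  refine le_of_forall_pos_le_add fun ε hε => ?_
  have hn : (0 : ℝ) < n + 1 := by positivity
  obtain ⟨A, hA, hle⟩ := exists_rearrSum_le x (div_pos hε hn) n
  have h1 := h A hA
  have h2 : (n : ℝ) * (ε / (n + 1)) ≤ ε := by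
    rw [mul_div_assoc', div_le_iff₀ hn]
    nlinarith
  linarith

theorem IsBddSeq.add {x y : ℕ → 𝕜} (hx : IsBddSeq x) (hy : IsBddSeq y) : IsBddSeq (x + y) := by
  obtain ⟨C, hC⟩ := hx
  obtain ⟨D, hD⟩ := hy
  exact ⟨C + D, fun i => (norm_add_le _ _).trans (add_le_add (hC i) (hD i))⟩

theorem IsBddSeq.smul (c : 𝕜) {x : ℕ → 𝕜} (hx : IsBddSeq x) : IsBddSeq (c • x) := by
  obtain ⟨C, hC⟩ := hx
  refine ⟨‖c‖ * C, fun i => ?_⟩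
  rw [Pi.smul_apply, norm_smul]
  exact mul_le_mul_of_nonneg_left (hC i) (norm_nonneg _)

theorem rearrSum_add_le {x y : ℕ → 𝕜} (hx : IsBddSeq x) (hy : IsBddSeq y) (n : ℕ) :
    rearrSum (x + y) n ≤ rearrSum x n + rearrSum y n :=
  rearrSum_le_of_forall fun A hA =>
    calc ∑ i ∈ A, ‖(x + y) i‖ ≤ ∑ i ∈ A, (‖x i‖ + ‖y i‖) :=
          Finset.sum_le_sum fun _ _ => norm_add_le _ _
      _ = ∑ i ∈ A, ‖x i‖ + ∑ i ∈ A, ‖y i‖ := Finset.sum_add_distrib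
      _ ≤ _ := add_le_add (sum_le_rearrSum hx n A hA) (sum_le_rearrSum hy n A hA)

theorem rearrSum_smul_le (c : 𝕜) {x : ℕ → 𝕜} (hx : IsBddSeq x) (n : ℕ) :
    rearrSum (c • x) n ≤ ‖c‖ * rearrSum x n :=
  rearrSum_le_of_forall fun A hA => by
    simp only [Pi.smul_apply, norm_smul, ← Finset.mul_sum]
    exact mul_le_mul_of_nonneg_left (sum_le_rearrSum hx n A hA) (norm_nonneg _)

theorem rearrSum_zero (n : ℕ) : rearrSum (0 : ℕ → 𝕜) n = 0 :=
  le_antisymm (rearrSum_le_of_forall fun A _ => by simp) (rearrSum_nonneg _ _)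

end Rearrangement

/-- The vector space underlying `d_*(w,1)`: the (bounded) scalar sequences `x` such that
`(x^*(1) + ⋯ + x^*(n)) / W(n)` tends to `0`. -/
def lorentzPredualSubmodule (𝕜 : Type*) [RCLike 𝕜] (w : AdmissibleSequence) :
    Submodule 𝕜 (ℕ → 𝕜) where
  carrier := {x | IsBddSeq x ∧ Tendsto (fun n => rearrSum x n / w.W n) atTop (𝓝 0)}
  zero_mem' := ⟨⟨0, fun i => by simp⟩, by simp [rearrSum_zero]⟩
  add_mem' := by
    rintro x y ⟨hx, hx0⟩ ⟨hy, hy0⟩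
    refine ⟨hx.add hy, ?_⟩
    have hW : ∀ n, 0 ≤ w.W n := fun n => Finset.sum_nonneg fun i _ => w.nonneg i
    refine squeeze_zero (fun n => div_nonneg (rearrSum_nonneg _ _) (hW n)) (fun n => ?_)
      (by simpa using hx0.add hy0)
    rw [← add_div]
    exact div_le_div_of_nonneg_right (rearrSum_add_le hx hy n) (hW n)
  smul_mem' := by
    rintro c x ⟨hx, hx0⟩
    refine ⟨hx.smul c, ?_⟩
    have hW : ∀ n, 0 ≤ w.W n := fun n => Finset.sum_nonneg fun i _ => w.nonneg i
    refine squeeze_zero (fun n => div_nonneg (rearrSum_nonneg _ _) (hW n)) (fun n => ?_)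
      (by simpa using hx0.const_mul ‖c‖)
    rw [← mul_div_assoc]
    exact div_le_div_of_nonneg_right (rearrSum_smul_le c hx n) (hW n)

/-- The predual `d_*(w,1)` of the Lorentz sequence space `d(w,1)` over `𝕜`. It is a type of its
own, so that its only topology is the one of the norm defined below. -/
def LorentzPredual (𝕜 : Type*) [RCLike 𝕜] (w : AdmissibleSequence) : Type _ :=
  ↥(lorentzPredualSubmodule 𝕜 w)

namespace LorentzPredual

variable {𝕜 : Type*} [RCLike 𝕜] {w : AdmissibleSequence}

noncomputable instance : AddCommGroup (LorentzPredual 𝕜 w) :=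
  inferInstanceAs (AddCommGroup ↥(lorentzPredualSubmodule 𝕜 w))

noncomputable instance : Module 𝕜 (LorentzPredual 𝕜 w) :=
  inferInstanceAs (Module 𝕜 ↥(lorentzPredualSubmodule 𝕜 w))

/-- The sequence underlying an element of `d_*(w,1)`. -/
def seq (x : LorentzPredual 𝕜 w) : ℕ → 𝕜 := x.1

theorem bdd_seq (x : LorentzPredual 𝕜 w) : IsBddSeq x.seq := x.2.1

theorem seq_add (x y : LorentzPredual 𝕜 w) : (x + y).seq = x.seq + y.seq := rfl

theorem seq_smul (c : 𝕜) (x : LorentzPredual 𝕜 w) : (c • x).seq = c • x.seq := rfl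

theorem seq_zero : (0 : LorentzPredual 𝕜 w).seq = 0 := rfl

/-- The norm of `d_*(w,1)`: the supremum over `n ≥ 1` of
`(x^*(1) + ⋯ + x^*(n)) / W(n)`. -/
noncomputable instance : Norm (LorentzPredual 𝕜 w) where
  norm x := ⨆ n : ℕ, rearrSum x.seq (n + 1) / w.W (n + 1)

theorem norm_eq (x : LorentzPredual 𝕜 w) :
    ‖x‖ = ⨆ n : ℕ, rearrSum x.seq (n + 1) / w.W (n + 1) := rfl

theorem bddAbove (x : LorentzPredual 𝕜 w) :
    BddAbove (Set.range fun n : ℕ => rearrSum x.seq (n + 1) / w.W (n + 1)) :=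
  ((tendsto_add_atTop_iff_nat (f := fun n => rearrSum x.seq n / w.W n) 1).2 x.2.2).bddAbove_range

theorem le_norm (x : LorentzPredual 𝕜 w) (n : ℕ) :
    rearrSum x.seq (n + 1) ≤ ‖x‖ * w.W (n + 1) := by
  rw [← div_le_iff₀ (zero_lt_one.trans_le (w.one_le_W n))]
  exact le_ciSup x.bddAbove n

theorem norm_le {x : LorentzPredual 𝕜 w} {C : ℝ}
    (h : ∀ n, rearrSum x.seq (n + 1) ≤ C * w.W (n + 1)) : ‖x‖ ≤ C :=
  ciSup_le fun n => (div_le_iff₀ (zero_lt_one.trans_le (w.one_le_W n))).2 (h n)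

theorem norm_nonneg_aux (x : LorentzPredual 𝕜 w) : 0 ≤ ‖x‖ :=
  Real.iSup_nonneg fun n =>
    div_nonneg (rearrSum_nonneg _ _) (zero_le_one.trans (w.one_le_W n))

theorem norm_smul_le_aux (c : 𝕜) (x : LorentzPredual 𝕜 w) : ‖c • x‖ ≤ ‖c‖ * ‖x‖ :=
  norm_le fun n => by
    rw [seq_smul, mul_assoc]
    exact (rearrSum_smul_le c x.bdd_seq _).trans
      (mul_le_mul_of_nonneg_left (x.le_norm n) (norm_nonneg c))

theorem norm_neg_le_aux (x : LorentzPredual 𝕜 w) : ‖-x‖ ≤ ‖x‖ := by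
  have h := norm_smul_le_aux (-1 : 𝕜) x
  rw [neg_one_smul] at h
  simpa using h

noncomputable instance : NormedAddCommGroup (LorentzPredual 𝕜 w) :=
  AddGroupNorm.toNormedAddCommGroup
    { toFun := fun x => ‖x‖
      map_zero' := le_antisymm
        (norm_le fun n => by rw [seq_zero, rearrSum_zero, zero_mul]) (norm_nonneg_aux _)
      add_le' := fun x y => norm_le fun n => by
        rw [seq_add, add_mul]
        exact (rearrSum_add_le x.bdd_seq y.bdd_seq _).trans
          (add_le_add (x.le_norm n) (y.le_norm n))
      neg' := fun x => le_antisymm (norm_neg_le_aux x) (by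
        have h := norm_neg_le_aux (-x)
        rwa [neg_neg] at h)
      eq_zero_of_map_eq_zero' := fun x hx => by
        have h0 : ∀ i, x.seq i = 0 := fun i => by
          have h1 := sum_le_rearrSum x.bdd_seq 1 {i} (Finset.card_singleton i)
          have h2 := x.le_norm 0
          have h3 : ‖x‖ = 0 := hx
          rw [h3, zero_mul] at h2
          rw [Finset.sum_singleton] at h1
          exact norm_le_zero_iff.1 (h1.trans h2)
        exact Subtype.ext (funext h0) }

noncomputable instance : NormedSpace 𝕜 (LorentzPredual 𝕜 w) where
  norm_smul_le := norm_smul_le_aux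

end LorentzPredual

/-! ## Continuous polynomials between normed spaces -/

section Polynomials

variable (𝕜 : Type*) [RCLike 𝕜] (k : ℕ)
  (X : Type*) [NormedAddCommGroup X] [NormedSpace 𝕜 X]
  (Y : Type*) [NormedAddCommGroup Y] [NormedSpace 𝕜 Y]

/-- The continuous `k`-homogeneous polynomials: the maps `x ↦ Φ (x, …, x)` with `Φ` a continuous
`k`-linear map. -/
def homPolySubmodule : Submodule 𝕜 (X → Y) where
  carrier := {f | ∃ Φ : ContinuousMultilinearMap 𝕜 (fun _ : Fin k => X) Y,
    ∀ x, f x = Φ fun _ => x}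
  zero_mem' := ⟨0, fun _ => rfl⟩
  add_mem' := by
    rintro f g ⟨Φ, hΦ⟩ ⟨Ψ, hΨ⟩
    exact ⟨Φ + Ψ, fun x => by simp [hΦ, hΨ]⟩
  smul_mem' := by
    rintro c f ⟨Φ, hΦ⟩
    exact ⟨c • Φ, fun x => by simp [hΦ]⟩

/-- The continuous polynomials of degree at most `k`: the sums `P_0 + ⋯ + P_k` with `P_j` a
continuous `j`-homogeneous polynomial. -/
def polySubmodule : Submodule 𝕜 (X → Y) where
  carrier := {f | ∃ P : ℕ → X → Y, (∀ j, P j ∈ homPolySubmodule 𝕜 j X Y) ∧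
    ∀ x, f x = ∑ j ∈ Finset.range (k + 1), P j x}
  zero_mem' := ⟨0, fun _ => Submodule.zero_mem _, fun _ => by simp⟩
  add_mem' := by
    rintro f g ⟨P, hP, hf⟩ ⟨Q, hQ, hg⟩
    exact ⟨P + Q, fun j => Submodule.add_mem _ (hP j) (hQ j), fun x => by
      simp [hf, hg, Finset.sum_add_distrib]⟩
  smul_mem' := by
    rintro c f ⟨P, hP, hf⟩
    exact ⟨c • P, fun j => Submodule.smul_mem _ c (hP j), fun x => by
      simp [hf, Finset.smul_sum]⟩

variable {𝕜 k X Y}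

theorem homPolySubmodule_le : homPolySubmodule 𝕜 k X Y ≤ polySubmodule 𝕜 k X Y := by
  classical
  intro f hf
  refine ⟨Pi.single k f, fun j => ?_, fun x => ?_⟩
  · by_cases h : j = k
    · subst h
      simpa using hf
    · rw [Pi.single_eq_of_ne h]
      exact Submodule.zero_mem _
  · rw [Finset.sum_eq_single k]
    · simp
    · intro j _ hj
      rw [Pi.single_eq_of_ne hj]
      rfl
    · simp

/-- The supremum of `‖f x‖` over the closed unit ball. -/
noncomputable def ballNorm (f : X → Y) : ℝ := ⨆ x : Metric.closedBall (0 : X) 1, ‖f x‖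

theorem bddAbove_of_mem_poly {f : X → Y} (hf : f ∈ polySubmodule 𝕜 k X Y) :
    BddAbove (Set.range fun x : Metric.closedBall (0 : X) 1 => ‖f x‖) := by
  obtain ⟨P, hP, hf⟩ := hf
  choose Φ hΦ using hP
  refine ⟨∑ j ∈ Finset.range (k + 1), ‖Φ j‖, ?_⟩
  rintro _ ⟨⟨x, hx⟩, rfl⟩
  have hx1 : ‖x‖ ≤ 1 := by simpa using hx
  simp only [hf]
  refine (norm_sum_le _ _).trans (Finset.sum_le_sum fun j _ => ?_)
  rw [hΦ]
  refine ((Φ j).le_opNorm _).trans ?_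
  rw [Finset.prod_const]
  exact mul_le_of_le_one_right (norm_nonneg _) (pow_le_one₀ (norm_nonneg _) hx1)

theorem norm_le_ballNorm {f : X → Y} (hf : f ∈ polySubmodule 𝕜 k X Y) {x : X} (hx : ‖x‖ ≤ 1) :
    ‖f x‖ ≤ ballNorm f :=
  le_ciSup (bddAbove_of_mem_poly hf) ⟨x, by simpa using hx⟩

theorem ballNorm_le {f : X → Y} {C : ℝ} (h : ∀ x, ‖x‖ ≤ 1 → ‖f x‖ ≤ C) : ballNorm f ≤ C :=
  haveI : Nonempty (Metric.closedBall (0 : X) 1) := ⟨⟨0, by simp⟩⟩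
  ciSup_le fun x => h x.1 (mem_closedBall_zero_iff.1 x.2)

theorem ballNorm_zero : ballNorm (0 : X → Y) = 0 := by
  simp [ballNorm]

theorem ballNorm_neg (f : X → Y) : ballNorm (-f) = ballNorm f := by
  simp [ballNorm]

theorem ballNorm_add_le {f g : X → Y} (hf : f ∈ polySubmodule 𝕜 k X Y)
    (hg : g ∈ polySubmodule 𝕜 k X Y) : ballNorm (f + g) ≤ ballNorm f + ballNorm g :=
  ballNorm_le fun _ hx => (norm_add_le _ _).trans
    (add_le_add (norm_le_ballNorm hf hx) (norm_le_ballNorm hg hx))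

theorem ballNorm_smul_le (c : 𝕜) {f : X → Y} (hf : f ∈ polySubmodule 𝕜 k X Y) :
    ballNorm (c • f) ≤ ‖c‖ * ballNorm f :=
  ballNorm_le fun x hx => by
    rw [Pi.smul_apply, norm_smul]
    exact mul_le_mul_of_nonneg_left (norm_le_ballNorm hf hx) (norm_nonneg _)

theorem eq_zero_of_ballNorm_eq_zero {f : X → Y} (hf : f ∈ polySubmodule 𝕜 k X Y)
    (h : ballNorm f = 0) : f = 0 := by
  have hball : ∀ x, ‖x‖ ≤ 1 → f x = 0 := fun x hx =>
    norm_le_zero_iff.1 ((norm_le_ballNorm hf hx).trans_eq h)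
  obtain ⟨P, hP, hfP⟩ := hf
  choose Φ hΦ using hP
  have hhom : ∀ (t : 𝕜) (x : X) (j : ℕ), P j (t • x) = t ^ j • P j x := fun t x j => by
    rw [hΦ, hΦ]
    simpa using (Φ j).map_smul_univ (fun _ => t) (fun _ => x)
  funext x
  refine (SeparatingDual.eq_zero_iff_forall_dual_eq_zero (R := 𝕜) (f x)).2 fun l => ?_
  let p : Polynomial 𝕜 := ∑ j ∈ Finset.range (k + 1), Polynomial.monomial j (l (P j x))
  have hp : ∀ t : 𝕜, p.eval t = l (f (t • x)) := fun t => by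
    simp [p, hfP, hhom, Polynomial.eval_finsetSum, mul_comm]
  have hp0 : p = 0 := by
    refine Polynomial.eq_zero_of_infinite_isRoot p (Set.Infinite.mono ?_
      (Set.infinite_range_of_injective
        (f := fun n : ℕ => (((1 : ℝ) / ((n : ℝ) + 1 + ‖x‖) : ℝ) : 𝕜)) ?_))
    · rintro _ ⟨n, rfl⟩
      have hpos : 0 < (n : ℝ) + 1 + ‖x‖ := by positivity
      change p.eval _ = 0
      rw [hp, hball, map_zero]
      rw [norm_smul, RCLike.norm_ofReal, abs_of_pos (by positivity), one_div,
        inv_mul_le_iff₀ hpos]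
      have : (0 : ℝ) ≤ n := Nat.cast_nonneg n
      linarith
    · intro m n hmn
      have h1 := RCLike.ofReal_injective hmn
      simp only [one_div, inv_inj, add_left_inj, Nat.cast_inj] at h1
      exact h1
  have h1 := hp 1
  rw [hp0, one_smul] at h1
  simpa using h1.symm

variable (𝕜 k X Y)

/-- The space of continuous `k`-homogeneous polynomials from `X` to `Y`, with the supremum norm on
the closed unit ball of `X` (a type of its own, so that its only topology is the norm topology). -/
def HomPoly : Type _ := ↥(homPolySubmodule 𝕜 k X Y)

/-- The space of continuous polynomials from `X` to `Y` of degree at most `k`, with the supremum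
norm on the closed unit ball of `X`. -/
def PolyDegLE : Type _ := ↥(polySubmodule 𝕜 k X Y)

variable {𝕜 k X Y}

namespace HomPoly

noncomputable instance : AddCommGroup (HomPoly 𝕜 k X Y) :=
  inferInstanceAs (AddCommGroup ↥(homPolySubmodule 𝕜 k X Y))

noncomputable instance : Module 𝕜 (HomPoly 𝕜 k X Y) :=
  inferInstanceAs (Module 𝕜 ↥(homPolySubmodule 𝕜 k X Y))

instance : CoeFun (HomPoly 𝕜 k X Y) fun _ => X → Y := ⟨fun P => P.1⟩

theorem mem_poly (P : HomPoly 𝕜 k X Y) : (P : X → Y) ∈ polySubmodule 𝕜 k X Y :=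
  homPolySubmodule_le P.2

noncomputable instance : Norm (HomPoly 𝕜 k X Y) := ⟨fun P => ballNorm (P : X → Y)⟩

noncomputable instance : NormedAddCommGroup (HomPoly 𝕜 k X Y) :=
  AddGroupNorm.toNormedAddCommGroup
    { toFun := fun P => ‖P‖
      map_zero' := ballNorm_zero
      add_le' := fun P Q => ballNorm_add_le P.mem_poly Q.mem_poly
      neg' := fun P => ballNorm_neg (P : X → Y)
      eq_zero_of_map_eq_zero' := fun P hP =>
        Subtype.ext (eq_zero_of_ballNorm_eq_zero P.mem_poly hP) }

noncomputable instance : NormedSpace 𝕜 (HomPoly 𝕜 k X Y) where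
  norm_smul_le c P := ballNorm_smul_le c P.mem_poly

/-- The norm attaining `k`-homogeneous polynomials. -/
def normAttaining (𝕜 : Type*) [RCLike 𝕜] (k : ℕ)
    (X : Type*) [NormedAddCommGroup X] [NormedSpace 𝕜 X]
    (Y : Type*) [NormedAddCommGroup Y] [NormedSpace 𝕜 Y] : Set (HomPoly 𝕜 k X Y) :=
  {P | ∃ x : X, ‖x‖ ≤ 1 ∧ ‖P x‖ = ‖P‖}

end HomPoly

namespace PolyDegLE

noncomputable instance : AddCommGroup (PolyDegLE 𝕜 k X Y) :=
  inferInstanceAs (AddCommGroup ↥(polySubmodule 𝕜 k X Y))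

noncomputable instance : Module 𝕜 (PolyDegLE 𝕜 k X Y) :=
  inferInstanceAs (Module 𝕜 ↥(polySubmodule 𝕜 k X Y))

instance : CoeFun (PolyDegLE 𝕜 k X Y) fun _ => X → Y := ⟨fun P => P.1⟩

noncomputable instance : Norm (PolyDegLE 𝕜 k X Y) := ⟨fun P => ballNorm (P : X → Y)⟩

noncomputable instance : NormedAddCommGroup (PolyDegLE 𝕜 k X Y) :=
  AddGroupNorm.toNormedAddCommGroup
    { toFun := fun P => ‖P‖
      map_zero' := ballNorm_zero
      add_le' := fun P Q => ballNorm_add_le P.2 Q.2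
      neg' := fun P => ballNorm_neg (P : X → Y)
      eq_zero_of_map_eq_zero' := fun P hP =>
        Subtype.ext (eq_zero_of_ballNorm_eq_zero P.2 hP) }

noncomputable instance : NormedSpace 𝕜 (PolyDegLE 𝕜 k X Y) where
  norm_smul_le c P := ballNorm_smul_le c P.2

/-- The norm attaining polynomials of degree at most `k`. -/
def normAttaining (𝕜 : Type*) [RCLike 𝕜] (k : ℕ)
    (X : Type*) [NormedAddCommGroup X] [NormedSpace 𝕜 X]
    (Y : Type*) [NormedAddCommGroup Y] [NormedSpace 𝕜 Y] : Set (PolyDegLE 𝕜 k X Y) :=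
  {P | ∃ x : X, ‖x‖ ≤ 1 ∧ ‖P x‖ = ‖P‖}

end PolyDegLE

end Polynomials

/-! The dichotomy is governed by the behaviour of scalar forms far out along the basis of
`d_*(w,1)`.

Suppose `w ∉ ℓ_N`. A continuous form with at most `N` varying arguments tends to zero uniformly as
soon as one of them runs off to infinity (`vanishes_of_not_summable`). Otherwise a gliding hump
makes the form unbounded: at stage `k`, blocks on which the form stays large are added to the
arguments, the basis vectors among them scaled by `w k`. The arguments stay bounded, while each
stage raises the modulus of the form by a fixed multiple of `w k ^ N`. Terms mixing old and new
blocks are negligible by induction on the freedom of the arguments. Hence a scalar polynomial of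
degree at most `N` is uniformly close, on the unit ball, to its truncation to finitely many
coordinates, and the truncation attains its maximum by compactness. For a `c₀`-valued polynomial,
one almost norming coordinate is replaced by a slightly enlarged truncation, which then dominates
all other coordinates (`exists_replaceCoord_attaining`).

Suppose `w ∈ ℓ_N`, and let `M` be the least exponent with `w ∈ ℓ_M`, so `2 ≤ M ≤ N`. The
rearrangement of a unit vector is majorized by `w`, so `x_0 ^ (N - M) * ∑ x_i ^ M` is a continuous
`N`-homogeneous polynomial. Let `R` be a small perturbation of degree at most `N` and `x₀` a
supposed maximum point. A vector `x₀ + c e_n` stays in the ball for a fixed small `‖c‖` and all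
large `n`. Along `e_n` the coefficients of `R` of orders `1, …, M - 1` tend to zero because `w ∉
ℓ_{M-1}`, and those of order at least `M` are small with `R`. The power sum contributes `x₀(0) ^ (N
- M) * c ^ M`, which with the right phase of `c` strictly increases the modulus
(`exists_powerSum_not_attaining`). Placing this polynomial in one coordinate of `c₀` gives a single
example that refutes density in both spaces. -/

namespace AdmissibleSequence

/-! ### Admissible sequences -/

variable (w : AdmissibleSequence)

/-- A decreasing nonnegative sequence with a zero term is finitely supported, hence summable. -/
theorem toFun_pos (n : ℕ) : 0 < w.toFun n := by
  refine (w.nonneg n).lt_of_ne fun h => w.not_summable ?_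
  refine summable_of_ne_finset_zero (s := Finset.range n) fun i hi => ?_
  have hni : n ≤ i := by simpa using hi
  exact le_antisymm ((w.antitone hni).trans_eq h.symm) (w.nonneg i)

theorem toFun_le_one (n : ℕ) : w.toFun n ≤ 1 := by
  rw [← w.zero_eq_one]
  exact w.antitone n.zero_le

theorem W_zero : w.W 0 = 0 := by simp [W]

theorem W_succ (n : ℕ) : w.W (n + 1) = w.W n + w.toFun n := Finset.sum_range_succ _ _

theorem W_nonneg (n : ℕ) : 0 ≤ w.W n := Finset.sum_nonneg fun i _ => w.nonneg i

theorem W_mono : Monotone w.W :=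
  monotone_nat_of_le_succ fun n => by
    rw [W_succ]
    linarith [w.nonneg n]

theorem W_le (n : ℕ) : w.W n ≤ n := by
  have h := Finset.sum_le_card_nsmul (Finset.range n) w.toFun 1 fun i _ => w.toFun_le_one i
  simpa [W] using h

theorem tendsto_W : Tendsto w.W atTop atTop :=
  (not_summable_iff_tendsto_nat_atTop_of_nonneg w.nonneg).1 w.not_summable

theorem summable_pow_of_le {p q : ℕ} (hpq : p ≤ q) (h : Summable fun i => w.toFun i ^ p) :
    Summable fun i => w.toFun i ^ q :=
  h.of_nonneg_of_le (fun i => pow_nonneg (w.nonneg i) _)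
    fun i => pow_le_pow_of_le_one (w.nonneg i) (w.toFun_le_one i) hpq

theorem memℓp_iff {N : ℕ} (hN : N ≠ 0) :
    Memℓp w.toFun (N : ENNReal) ↔ Summable fun i => w.toFun i ^ N := by
  rw [memℓp_gen_iff (by simpa using Nat.pos_of_ne_zero hN)]
  refine summable_congr fun i => ?_
  rw [Real.norm_of_nonneg (w.nonneg i)]
  simp

end AdmissibleSequence

section Rearrangement

variable {𝕜 : Type*} [RCLike 𝕜]

theorem IsBddSeq.of_norm_le {x y : ℕ → 𝕜} (hx : IsBddSeq x) (h : ∀ i, ‖y i‖ ≤ ‖x i‖) :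
    IsBddSeq y := by
  obtain ⟨C, hC⟩ := hx
  exact ⟨C, fun i => (h i).trans (hC i)⟩

theorem rearrSum_mono {x y : ℕ → 𝕜} (hx : IsBddSeq x) (h : ∀ i, ‖y i‖ ≤ ‖x i‖) (n : ℕ) :
    rearrSum y n ≤ rearrSum x n :=
  rearrSum_le_of_forall fun A hA =>
    (Finset.sum_le_sum fun i _ => h i).trans (sum_le_rearrSum hx n A hA)

end Rearrangement

/-! ### Coordinates, restrictions and norm estimates in `d_*(w,1)` -/

namespace LorentzPredual

variable {𝕜 : Type*} [RCLike 𝕜] {w : AdmissibleSequence}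

@[ext]
theorem ext {x y : LorentzPredual 𝕜 w} (h : ∀ i, x.seq i = y.seq i) : x = y :=
  Subtype.ext (funext h)

@[simp]
theorem seq_add_apply (x y : LorentzPredual 𝕜 w) (i : ℕ) : (x + y).seq i = x.seq i + y.seq i := rfl

@[simp]
theorem seq_smul_apply (c : 𝕜) (x : LorentzPredual 𝕜 w) (i : ℕ) :
    (c • x).seq i = c * x.seq i := rfl

@[simp]
theorem seq_zero_apply (i : ℕ) : (0 : LorentzPredual 𝕜 w).seq i = 0 := rfl

theorem rearrSum_le_norm_mul_W (x : LorentzPredual 𝕜 w) (n : ℕ) :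
    rearrSum x.seq n ≤ ‖x‖ * w.W n := by
  cases n with
  | zero => simp [rearrSum, w.W_zero]
  | succ n => exact x.le_norm n

theorem sum_le_norm_mul_W (x : LorentzPredual 𝕜 w) (A : Finset ℕ) :
    ∑ i ∈ A, ‖x.seq i‖ ≤ ‖x‖ * w.W A.card :=
  (sum_le_rearrSum x.bdd_seq _ A rfl).trans (x.rearrSum_le_norm_mul_W _)

theorem norm_le_of_sum_le {x : LorentzPredual 𝕜 w} {C : ℝ}
    (h : ∀ A : Finset ℕ, ∑ i ∈ A, ‖x.seq i‖ ≤ C * w.W A.card) : ‖x‖ ≤ C :=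
  norm_le fun n => rearrSum_le_of_forall fun A hA => by simpa [hA] using h A

theorem norm_seq_le (x : LorentzPredual 𝕜 w) (i : ℕ) : ‖x.seq i‖ ≤ ‖x‖ := by
  have h := x.sum_le_norm_mul_W {i}
  simpa [AdmissibleSequence.W, w.zero_eq_one] using h

theorem norm_le_of_norm_seq_le {x y : LorentzPredual 𝕜 w} (h : ∀ i, ‖y.seq i‖ ≤ ‖x.seq i‖) :
    ‖y‖ ≤ ‖x‖ :=
  norm_le_of_sum_le fun A => (Finset.sum_le_sum fun i _ => h i).trans (x.sum_le_norm_mul_W A)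

/-- The coordinate functionals. -/
noncomputable def coord (i : ℕ) : LorentzPredual 𝕜 w →L[𝕜] 𝕜 :=
  LinearMap.mkContinuous
    { toFun := fun x => x.seq i
      map_add' := fun _ _ => rfl
      map_smul' := fun _ _ => rfl } 1 fun x => by
    rw [one_mul]
    exact x.norm_seq_le i

@[simp]
theorem coord_apply (i : ℕ) (x : LorentzPredual 𝕜 w) : coord i x = x.seq i := rfl

@[simp]
theorem seq_sum_apply {ι : Type*} (s : Finset ι) (f : ι → LorentzPredual 𝕜 w) (i : ℕ) :
    (∑ j ∈ s, f j).seq i = ∑ j ∈ s, (f j).seq i := by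
  simp only [← coord_apply, map_sum]

/-- Infinitely many coordinates of modulus at least `ε` would give `rearrSum x.seq n ≥ n * ε ≥ ε * W
n` for all `n`, against the defining limit of the space. -/
theorem tendsto_seq (x : LorentzPredual 𝕜 w) : Tendsto x.seq atTop (𝓝 0) := by
  rw [tendsto_zero_iff_norm_tendsto_zero, Metric.tendsto_atTop]
  by_contra! hcon
  obtain ⟨ε, hε, hcon⟩ := hcon
  have hinf : {i | ε ≤ ‖x.seq i‖}.Infinite :=
    Set.infinite_of_forall_exists_gt fun n => by
      obtain ⟨i, hi, h⟩ := hcon (n + 1)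
      refine ⟨i, ?_, hi⟩
      simpa using h
  have hle : ∀ n : ℕ, n * ε ≤ rearrSum x.seq n := fun n => by
    obtain ⟨A, hA, hcard⟩ := hinf.exists_subset_card_eq n
    refine le_trans ?_ (sum_le_rearrSum x.bdd_seq n A hcard)
    have := A.card_nsmul_le_sum (fun i => ‖x.seq i‖) ε fun i hi => hA hi
    simpa [hcard] using this
  obtain ⟨n, hn1, hn2⟩ :=
    ((x.2.2.eventually (gt_mem_nhds hε)).and (eventually_ge_atTop 1)).exists
  have hW : 0 < w.W n := by
    obtain ⟨k, rfl⟩ := Nat.exists_eq_succ_of_ne_zero (Nat.one_le_iff_ne_zero.1 hn2)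
    exact zero_lt_one.trans_le (w.one_le_W k)
  have hn3 : rearrSum x.seq n < ε * w.W n := (div_lt_iff₀ hW).1 hn1
  nlinarith [hle n, w.W_le n]

/-- The element of `d_*(w,1)` given by a sequence dominated by an element of `d_*(w,1)`. -/
def ofNormLe (x : LorentzPredual 𝕜 w) (y : ℕ → 𝕜) (h : ∀ i, ‖y i‖ ≤ ‖x.seq i‖) :
    LorentzPredual 𝕜 w :=
  ⟨y, x.bdd_seq.of_norm_le h, squeeze_zero (fun n => div_nonneg (rearrSum_nonneg _ _) (w.W_nonneg n))
    (fun n => div_le_div_of_nonneg_right (rearrSum_mono x.bdd_seq h n) (w.W_nonneg n)) x.2.2⟩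

open Classical in
/-- The restriction of an element of `d_*(w,1)` to a set of indices. -/
noncomputable def restrict (S : Set ℕ) : LorentzPredual 𝕜 w →ₗ[𝕜] LorentzPredual 𝕜 w where
  toFun x := ofNormLe x (fun i => if i ∈ S then x.seq i else 0) fun i => by split_ifs <;> simp
  map_add' x y := ext fun i => by
    change (if i ∈ S then x.seq i + y.seq i else 0) =
      (if i ∈ S then x.seq i else 0) + if i ∈ S then y.seq i else 0
    split_ifs <;> simp
  map_smul' c x := ext fun i => by
    change (if i ∈ S then c * x.seq i else 0) = c * if i ∈ S then x.seq i else 0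
    split_ifs <;> simp

open Classical in
theorem seq_restrict (S : Set ℕ) (x : LorentzPredual 𝕜 w) (i : ℕ) :
    (restrict S x).seq i = if i ∈ S then x.seq i else 0 := rfl

theorem norm_seq_restrict_le (S : Set ℕ) (x : LorentzPredual 𝕜 w) (i : ℕ) :
    ‖(restrict S x).seq i‖ ≤ ‖x.seq i‖ := by
  rw [seq_restrict]
  split_ifs <;> simp

theorem norm_restrict_le (S : Set ℕ) (x : LorentzPredual 𝕜 w) : ‖restrict S x‖ ≤ ‖x‖ :=
  norm_le_of_norm_seq_le (norm_seq_restrict_le S x)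

theorem restrict_add_restrict_compl (S : Set ℕ) (x : LorentzPredual 𝕜 w) :
    restrict S x + restrict Sᶜ x = x := by
  ext i
  by_cases h : i ∈ S <;> simp [seq_restrict, h]

/-- The restriction to a set of indices, as a continuous linear map. -/
noncomputable def restrictL (S : Set ℕ) : LorentzPredual 𝕜 w →L[𝕜] LorentzPredual 𝕜 w :=
  (restrict S).mkContinuous 1 fun x => by
    rw [one_mul]
    exact norm_restrict_le S x

@[simp]
theorem restrictL_apply (S : Set ℕ) (x : LorentzPredual 𝕜 w) : restrictL S x = restrict S x := rfl

theorem sum_norm_single_le (i : ℕ) (A : Finset ℕ) :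
    ∑ j ∈ A, ‖(Pi.single i (1 : 𝕜) : ℕ → 𝕜) j‖ ≤ 1 := by
  have : ∀ j, ‖(Pi.single i (1 : 𝕜) : ℕ → 𝕜) j‖ = if i = j then 1 else 0 := fun j => by
    by_cases h : i = j
    · subst h; simp
    · simp [h]
  simp only [this, Finset.sum_ite_eq]
  split_ifs <;> simp

/-- The canonical basis vectors. -/
noncomputable def unit (𝕜 : Type*) [RCLike 𝕜] (w : AdmissibleSequence) (i : ℕ) :
    LorentzPredual 𝕜 w :=
  ⟨Pi.single i 1, ⟨1, fun j => by simpa using sum_norm_single_le (𝕜 := 𝕜) i {j}⟩, by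
    refine squeeze_zero (fun n => div_nonneg (rearrSum_nonneg _ _) (w.W_nonneg n)) (fun n => ?_)
      (w.tendsto_W.inv_tendsto_atTop)
    rw [Pi.inv_apply, ← one_div]
    exact div_le_div_of_nonneg_right
      (rearrSum_le_of_forall fun A _ => sum_norm_single_le i A) (w.W_nonneg n)⟩

theorem seq_unit (i j : ℕ) : (unit 𝕜 w i).seq j = if j = i then 1 else 0 := by
  change (Pi.single i (1 : 𝕜) : ℕ → 𝕜) j = _
  rw [Pi.single_apply]

@[simp]
theorem seq_unit_self (i : ℕ) : (unit 𝕜 w i).seq i = 1 := by simp [seq_unit]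

theorem norm_unit_le (i : ℕ) : ‖unit 𝕜 w i‖ ≤ 1 :=
  norm_le fun n => by
    rw [one_mul]
    exact (rearrSum_le_of_forall fun A _ => sum_norm_single_le i A).trans (w.one_le_W n)

theorem restrict_finset (A : Finset ℕ) (x : LorentzPredual 𝕜 w) :
    restrict (A : Set ℕ) x = ∑ i ∈ A, x.seq i • unit 𝕜 w i := by
  ext i
  simp [seq_restrict, seq_unit]

theorem restrict_Iio (n : ℕ) (x : LorentzPredual 𝕜 w) :
    restrict (Set.Iio n) x = ∑ i ∈ Finset.range n, x.seq i • unit 𝕜 w i := by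
  rw [← restrict_finset, Finset.coe_range]

/-- A vector of the closed unit ball stays there after a small perturbation of a far coordinate. -/
theorem exists_forall_norm_add_smul_unit_le_one {x : LorentzPredual 𝕜 w} (hx : ‖x‖ ≤ 1) :
    ∃ δ > 0, ∃ n₀, ∀ n ≥ n₀, ∀ c : 𝕜, ‖c‖ ≤ δ → ‖x + c • unit 𝕜 w n‖ ≤ 1 := by
  -- Sets of more than `L` indices use less than half of `W`, which leaves room for `c`. In smaller
  -- sets coordinate `n` has modulus at most `w L / 2 + w L / 2`, no more than the last weight
  -- available to the set.
  obtain ⟨L, hL⟩ := eventually_atTop.1 (x.2.2.eventually (gt_mem_nhds (half_pos one_pos)))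
  have hwL := w.toFun_pos L
  obtain ⟨n₀, hn₀⟩ := eventually_atTop.1
    ((x.tendsto_seq.norm).eventually (gt_mem_nhds ((norm_zero (E := 𝕜)).trans_lt (half_pos hwL))))
  refine ⟨w.toFun L / 2, half_pos hwL, n₀, fun n hn c hc => norm_le_of_sum_le fun A => ?_⟩
  have hsum : ∀ B : Finset ℕ, ∑ i ∈ B, ‖x.seq i‖ ≤ w.W B.card := fun B =>
    (x.sum_le_norm_mul_W B).trans (mul_le_of_le_one_left (w.W_nonneg _) hx)
  rw [one_mul]
  by_cases hnA : n ∈ A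
  · have h1 : ∀ i ∈ A.erase n, ‖(x + c • unit 𝕜 w n).seq i‖ = ‖x.seq i‖ := fun i hi => by
      simp [seq_unit, Finset.ne_of_mem_erase hi]
    have h2 : ‖(x + c • unit 𝕜 w n).seq n‖ ≤ ‖x.seq n‖ + ‖c‖ := by
      simpa using norm_add_le (x.seq n) c
    rw [← Finset.add_sum_erase A _ hnA, Finset.sum_congr rfl h1]
    by_cases hAL : A.card ≤ L
    · have hcard : A.card = (A.erase n).card + 1 := (Finset.card_erase_add_one hnA).symm
      rw [hcard, w.W_succ]
      have h3 : w.toFun L ≤ w.toFun (A.erase n).card := w.antitone (by omega)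
      linarith [hsum (A.erase n), hn₀ n hn]
    · have hW1 : 1 ≤ w.W A.card := by
        obtain ⟨k, hk⟩ := Nat.exists_eq_succ_of_ne_zero (n := A.card) (by omega)
        rw [hk]
        exact w.one_le_W k
      have h4 := hL A.card (by omega)
      rw [div_lt_iff₀ (by linarith)] at h4
      have h5 := sum_le_rearrSum x.bdd_seq _ A rfl
      rw [← Finset.add_sum_erase A _ hnA] at h5
      change rearrSum x.seq A.card < _ at h4
      linarith [w.toFun_le_one L]
  · refine le_of_eq_of_le (Finset.sum_congr rfl fun i hi => ?_) (hsum A)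
    have : i ≠ n := fun h => hnA (h ▸ hi)
    simp [seq_unit, this]

/-- Adding a vector of small supremum norm hardly increases the norm above `max ‖x‖ 1`. -/
theorem exists_forall_norm_add_le (x : LorentzPredual 𝕜 w) {η : ℝ} (hη : 0 < η) :
    ∃ δ > 0, ∀ t : LorentzPredual 𝕜 w, ‖t‖ ≤ 1 → (∀ i, ‖t.seq i‖ ≤ δ) →
      ‖x + t‖ ≤ max ‖x‖ 1 + η := by
  -- From `L` on, `x` contributes less than `η * W n` and `t` carries the norm. Up to `L`, the small
  -- coordinates of `t` add at most `η` in total.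
  obtain ⟨L, hL⟩ := eventually_atTop.1 (x.2.2.eventually (gt_mem_nhds hη))
  refine ⟨η / (L + 1), by positivity, fun t ht htδ => norm_le fun n => ?_⟩
  have hW := w.one_le_W n
  have hadd := rearrSum_add_le x.bdd_seq t.bdd_seq (n + 1)
  rw [seq_add]
  have hxn := x.le_norm n
  have htn := t.le_norm n
  by_cases hn : n + 1 ≤ L
  · have h1 : rearrSum t.seq (n + 1) ≤ η := rearrSum_le_of_forall fun A hA => by
      have h2 := A.sum_le_card_nsmul (fun i => ‖t.seq i‖) _ fun i _ => htδ i
      refine h2.trans ?_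
      rw [hA, nsmul_eq_mul, mul_div_assoc', div_le_iff₀ (by positivity), mul_comm]
      have h3 : ((n + 1 : ℕ) : ℝ) ≤ L + 1 := by exact_mod_cast hn.trans L.le_succ
      exact mul_le_mul_of_nonneg_left h3 hη.le
    nlinarith [le_max_left ‖x‖ 1]
  · have h4 := hL (n + 1) (by omega)
    rw [div_lt_iff₀ (by linarith)] at h4
    change rearrSum x.seq (n + 1) < _ at h4
    nlinarith [le_max_right ‖x‖ 1]

/-- The coordinates of modulus greater than `δ` of the vectors of the unit ball are boundedly
many. -/
theorem exists_card_bound (w : AdmissibleSequence) {δ : ℝ} (hδ : 0 < δ) :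
    ∃ K : ℕ, ∀ x : LorentzPredual 𝕜 w, ‖x‖ ≤ 1 →
      ∃ A : Finset ℕ, A.card ≤ K ∧ (A : Set ℕ) = {i | δ < ‖x.seq i‖} := by
  -- If `n` coordinates exceed `δ`, then `n * δ ≤ W n`; Cesàro means rule this out for large `n`.
  have hlim : Tendsto (fun n : ℕ => w.W n / n) atTop (𝓝 0) := by
    have h := w.tendsto_zero.cesaro
    refine h.congr fun n => ?_
    rw [div_eq_inv_mul]
    rfl
  obtain ⟨K, hK⟩ := eventually_atTop.1 (hlim.eventually (gt_mem_nhds hδ))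
  have key : ∀ x : LorentzPredual 𝕜 w, ‖x‖ ≤ 1 → ∀ A : Finset ℕ,
      (A : Set ℕ) ⊆ {i | δ < ‖x.seq i‖} → A.card ≤ K := fun x hx A hA => by
    by_contra! hlt
    have h1 := hK A.card hlt.le
    have hpos : (0 : ℝ) < A.card := by exact_mod_cast (Nat.zero_le K).trans_lt hlt
    rw [div_lt_iff₀ hpos] at h1
    have h2 := A.card_nsmul_le_sum (fun i => ‖x.seq i‖) δ fun i hi => le_of_lt (hA hi)
    have h3 := x.sum_le_norm_mul_W A
    rw [nsmul_eq_mul] at h2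
    nlinarith [w.W_nonneg A.card]
  refine ⟨K, fun x hx => ?_⟩
  have hfin : {i | δ < ‖x.seq i‖}.Finite := by
    by_contra hinf
    obtain ⟨A, hA, hcard⟩ := Set.Infinite.exists_subset_card_eq hinf (K + 1)
    have := key x hx A hA
    omega
  exact ⟨hfin.toFinset, key x hx _ (by simp), by simp⟩

end LorentzPredual

/-! ### Kinds of arguments, and reductions between them -/

namespace LorentzPredual

variable {𝕜 : Type*} [RCLike 𝕜] {w : AdmissibleSequence}

/-- The ways in which an argument of a multilinear form is allowed to vary: it is a given vector,
a multiple of a far basis vector, a vector of the unit ball with far support, or any vector of the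
unit ball. -/
inductive ArgKind (𝕜 : Type*) [RCLike 𝕜] (w : AdmissibleSequence)
  | fixed (v : LorentzPredual 𝕜 w)
  | basis
  | tail
  | free

namespace ArgKind

/-- The vectors allowed by an `ArgKind`, where "far" means "from index `m` on". -/
def Allowed (m : ℕ) : ArgKind 𝕜 w → LorentzPredual 𝕜 w → Prop
  | fixed v, x => x = v
  | basis, x => ∃ (c : 𝕜) (i : ℕ), ‖c‖ ≤ 1 ∧ m ≤ i ∧ x = c • unit 𝕜 w i
  | tail, x => ‖x‖ ≤ 1 ∧ ∀ i < m, x.seq i = 0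
  | free, x => ‖x‖ ≤ 1

/-- The kinds of arguments that go to infinity. -/
def Moving : ArgKind 𝕜 w → Prop
  | fixed _ => False
  | basis => True
  | tail => True
  | free => False

/-- A measure of the freedom of an argument. -/
def weight : ArgKind 𝕜 w → ℕ
  | fixed _ => 0
  | basis => 1
  | tail => 2
  | free => 3

theorem Allowed.mono {m n : ℕ} (hmn : m ≤ n) :
    ∀ {κ : ArgKind 𝕜 w} {x : LorentzPredual 𝕜 w}, κ.Allowed n x → κ.Allowed m x
  | fixed _, _, h => h
  | basis, _, ⟨c, i, hc, hi, hx⟩ => ⟨c, i, hc, hmn.trans hi, hx⟩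
  | tail, _, ⟨hx, hs⟩ => ⟨hx, fun i hi => hs i (hi.trans_le hmn)⟩
  | free, _, h => h

theorem Allowed.smul {m : ℕ} {c : 𝕜} (hc : ‖c‖ ≤ 1) :
    ∀ {κ : ArgKind 𝕜 w} {x : LorentzPredual 𝕜 w}, κ.Moving → κ.Allowed m x → κ.Allowed m (c • x)
  | basis, _, _, ⟨d, i, hd, hi, hx⟩ =>
    ⟨c * d, i, by rw [norm_mul]; exact mul_le_one₀ hc (norm_nonneg _) hd, hi, by
      rw [hx, smul_smul]⟩
  | tail, x, _, ⟨hx, hs⟩ =>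
    ⟨by rw [norm_smul]; exact mul_le_one₀ hc (norm_nonneg _) hx, fun i hi => by simp [hs i hi]⟩

theorem Allowed.tail_of_norm_seq_le {m : ℕ} {x y : LorentzPredual 𝕜 w}
    (hx : (tail : ArgKind 𝕜 w).Allowed m x) (h : ∀ i, ‖y.seq i‖ ≤ ‖x.seq i‖) :
    (tail : ArgKind 𝕜 w).Allowed m y :=
  ⟨(norm_le_of_norm_seq_le h).trans hx.1, fun i hi => by simpa [hx.2 i hi] using h i⟩

end ArgKind

theorem allowed_update {ι : Type*} [DecidableEq ι] {κ : ι → ArgKind 𝕜 w} {z : ι → LorentzPredual 𝕜 w} {m : ℕ} {j : ι}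
    {κ' : ArgKind 𝕜 w} {x : LorentzPredual 𝕜 w} (hz : ∀ i ≠ j, (κ i).Allowed m (z i))
    (hx : κ'.Allowed m x) (i : ι) :
    ((Function.update κ j κ') i).Allowed m (Function.update z j x i) := by
  by_cases h : i = j
  · subst h
    simpa using hx
  · simpa [h] using hz i h

variable {ι : Type*} [DecidableEq ι]

/-- A multilinear form vanishes at infinity along given kinds of arguments. -/
def Vanishes (Φ : ContinuousMultilinearMap 𝕜 (fun _ : ι => LorentzPredual 𝕜 w) 𝕜)
    (κ : ι → ArgKind 𝕜 w) : Prop :=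
  ∀ ε > 0, ∀ᶠ m in atTop, ∀ z : ι → LorentzPredual 𝕜 w, (∀ j, (κ j).Allowed m (z j)) → ‖Φ z‖ ≤ ε

variable {Φ : ContinuousMultilinearMap 𝕜 (fun _ : ι => LorentzPredual 𝕜 w) 𝕜}
  {κ : ι → ArgKind 𝕜 w}

/-- A free argument is split at a fixed index. -/
theorem vanishes_of_free {j : ι} (hj : κ j = .free)
    (htail : Vanishes Φ (Function.update κ j .tail))
    (hfix : ∀ i, Vanishes Φ (Function.update κ j (.fixed (unit 𝕜 w i)))) : Vanishes Φ κ := by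
  intro ε hε
  -- The cut `m₁` is fixed first, by the tail case. Only `m₁` basis vectors then remain, so each may
  -- be required to contribute at most `ε / 2 / (m₁ + 1)`.
  obtain ⟨m₁, hm₁⟩ := (htail (ε / 2) (half_pos hε)).exists
  have hε' : 0 < ε / 2 / (m₁ + 1) := by positivity
  filter_upwards [(Finset.range m₁).eventually_all.2 fun i _ => hfix i _ hε',
    eventually_ge_atTop m₁] with m hm hmm z hz
  have hzj : ‖z j‖ ≤ 1 := by
    have := hz j
    rwa [hj] at this
  have hz_eq : z = Function.update z j ((∑ i ∈ Finset.range m₁, (z j).seq i • unit 𝕜 w i) +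
      restrict (Set.Iio m₁)ᶜ (z j)) := by
    rw [← restrict_Iio, restrict_add_restrict_compl, Function.update_eq_self]
  have h1 : ‖Φ (Function.update z j (∑ i ∈ Finset.range m₁, (z j).seq i • unit 𝕜 w i))‖
      ≤ ε / 2 := by
    have : Φ (Function.update z j (∑ i ∈ Finset.range m₁, (z j).seq i • unit 𝕜 w i)) =
        ∑ i ∈ Finset.range m₁, Φ (Function.update z j ((z j).seq i • unit 𝕜 w i)) :=
      Φ.toMultilinearMap.map_update_sum _ _ _ _
    rw [this]
    refine (norm_sum_le_of_le (f := fun i => Φ (Function.update z j ((z j).seq i • unit 𝕜 w i)))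
      (n := fun _ => ε / 2 / (m₁ + 1)) _ fun i hi => ?_).trans ?_
    · rw [Φ.map_update_smul, norm_smul]
      have h := hm i hi _ (allowed_update (x := unit 𝕜 w i) (fun k _ => hz k) rfl)
      exact (mul_le_of_le_one_left (norm_nonneg _) (((z j).norm_seq_le i).trans hzj)).trans h
    · rw [Finset.sum_const, Finset.card_range, nsmul_eq_mul, mul_div_assoc',
        div_le_iff₀ (by positivity)]
      nlinarith
  have h2 : ‖Φ (Function.update z j (restrict (Set.Iio m₁)ᶜ (z j)))‖ ≤ ε / 2 :=
    hm₁ _ (allowed_update (fun k _ => (hz k).mono hmm)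
      ⟨(norm_restrict_le _ _).trans hzj, fun i hi => by simp [seq_restrict, hi]⟩)
  rw [hz_eq, Φ.map_update_add]
  linarith [norm_add_le (Φ (Function.update z j (∑ i ∈ Finset.range m₁, (z j).seq i • unit 𝕜 w i)))
    (Φ (Function.update z j (restrict (Set.Iio m₁)ᶜ (z j))))]

variable [Fintype ι]

/-- The large coordinates of tail arguments can be neglected. -/
theorem exists_small_tails (hκ : ∀ j, κ j = .tail → Vanishes Φ (Function.update κ j .basis))
    {δ ε : ℝ} (hδ : 0 < δ) (hε : 0 < ε) :
    ∀ᶠ m in atTop, ∀ z : ι → LorentzPredual 𝕜 w, (∀ j, (κ j).Allowed m (z j)) →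
      ∃ z' : ι → LorentzPredual 𝕜 w, (∀ j, (κ j).Allowed m (z' j)) ∧
        (∀ j, κ j = .tail → ∀ i, ‖(z' j).seq i‖ ≤ δ) ∧ ‖Φ z‖ ≤ ‖Φ z'‖ + ε := by
  classical
  obtain ⟨K, hK⟩ := exists_card_bound (𝕜 := 𝕜) w hδ
  set C : ℝ := ((Fintype.card (Finset ι) : ℕ) : ℝ) with hC
  have hCpos : 0 < C := by
    rw [hC]
    exact_mod_cast Fintype.card_pos
  have hε' : 0 < ε / C / (K + 1) := by positivity
  have hev : ∀ j, ∀ᶠ m in atTop, κ j = .tail → ∀ z : ι → LorentzPredual 𝕜 w,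
      (∀ i, (Function.update κ j .basis i).Allowed m (z i)) → ‖Φ z‖ ≤ ε / C / (K + 1) := fun j => by
    by_cases hj : κ j = .tail
    · filter_upwards [hκ j hj _ hε'] with m hm _ using hm
    · exact Eventually.of_forall fun m h => absurd h hj
  filter_upwards [eventually_all.2 hev] with m hm z hz
  -- `h` collects the coordinates above `δ` of the tail arguments and `t` the rest. In the expansion
  -- of `Φ (h + t)`, every term with a factor from `h` is small: either that factor is `0`, or it is
  -- a sum of at most `K` multiples of far basis vectors, to each of which the basis case applies.
  set h : ι → LorentzPredual 𝕜 w := fun j =>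
    if κ j = .tail then restrict {i | δ < ‖(z j).seq i‖} (z j) else 0 with hh
  set t : ι → LorentzPredual 𝕜 w := fun j =>
    if κ j = .tail then restrict {i | δ < ‖(z j).seq i‖}ᶜ (z j) else z j with ht
  have hz_eq : z = h + t := by
    funext j
    by_cases hj : κ j = .tail
    · simp only [hh, ht, Pi.add_apply, if_pos hj, restrict_add_restrict_compl]
    · simp only [hh, ht, Pi.add_apply, if_neg hj, zero_add]
  have htA : ∀ j, (κ j).Allowed m (t j) := fun j => by
    have hzj := hz j
    by_cases hj : κ j = .tail
    · simp only [ht, if_pos hj]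
      rw [hj] at hzj ⊢
      exact hzj.tail_of_norm_seq_le (norm_seq_restrict_le _ _)
    · simpa only [ht, if_neg hj] using hzj
  have hhA : ∀ j, κ j = .tail → (κ j).Allowed m (h j) := fun j hj => by
    have hzj := hz j
    simp only [hh, if_pos hj]
    rw [hj] at hzj ⊢
    exact hzj.tail_of_norm_seq_le (norm_seq_restrict_le _ _)
  refine ⟨t, htA, fun j hj i => ?_, ?_⟩
  · simp only [ht, if_pos hj, seq_restrict]
    split_ifs with hi
    · simpa using hi
    · simpa using hδ.le
  have hterm : ∀ s : Finset ι, s ≠ ∅ → ‖Φ (s.piecewise h t)‖ ≤ ε / C := fun s hs => by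
    by_cases hsR : ∀ j ∈ s, κ j = .tail
    · obtain ⟨j, hj⟩ := Finset.nonempty_iff_ne_empty.2 hs
      have hzj := hz j
      rw [hsR j hj] at hzj
      obtain ⟨A, hAK, hA⟩ := hK (z j) hzj.1
      have hhj : h j = ∑ i ∈ A, (z j).seq i • unit 𝕜 w i := by
        simp only [hh, if_pos (hsR j hj), ← hA, restrict_finset]
      have heq : s.piecewise h t =
          Function.update (s.piecewise h t) j (∑ i ∈ A, (z j).seq i • unit 𝕜 w i) := by
        rw [← hhj]
        refine (Function.update_eq_self_iff.2 ?_).symm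
        simp [hj]
      have hsum : Φ (s.piecewise h t) =
          ∑ i ∈ A, Φ (Function.update (s.piecewise h t) j ((z j).seq i • unit 𝕜 w i)) := by
        conv_lhs => rw [heq]
        exact Φ.toMultilinearMap.map_update_sum _ _ _ _
      rw [hsum]
      refine (norm_sum_le_of_le (n := fun _ => ε / C / (K + 1)) _ fun i hi => ?_).trans ?_
      · refine hm j (hsR j hj) _ (allowed_update (fun k _ => ?_) ?_)
        · by_cases hk : k ∈ s
          · simpa [hk] using hhA k (hsR k hk)
          · simpa [hk] using htA k
        · refine ⟨_, i, ((z j).norm_seq_le i).trans hzj.1, ?_, rfl⟩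
          by_contra! hlt
          have : δ < ‖(z j).seq i‖ := by
            have h' : i ∈ (A : Set ℕ) := hi
            rwa [hA] at h'
          rw [hzj.2 i hlt, norm_zero] at this
          linarith
      · rw [Finset.sum_const, nsmul_eq_mul, mul_div_assoc', div_le_iff₀ (by positivity)]
        have : (A.card : ℝ) ≤ K := by exact_mod_cast hAK
        have h2 : 0 < ε / C := by positivity
        nlinarith
    · push Not at hsR
      obtain ⟨j, hj, hjt⟩ := hsR
      have : Φ (s.piecewise h t) = 0 := Φ.map_coord_zero j (by simp [hj, hh, hjt])
      rw [this, norm_zero]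
      positivity
  rw [hz_eq, Φ.map_add_univ, ← Finset.add_sum_erase _ _ (Finset.mem_univ ∅)]
  refine (norm_add_le _ _).trans (add_le_add (by simp) ?_)
  refine (norm_sum_le_of_le (n := fun _ => ε / C) _ fun s hs =>
    hterm s (Finset.ne_of_mem_erase hs)).trans ?_
  rw [Finset.sum_const, nsmul_eq_mul, mul_div_assoc', div_le_iff₀ hCpos, mul_comm]
  refine mul_le_mul_of_nonneg_left ?_ hε.le
  rw [hC]
  exact_mod_cast Finset.card_le_univ _

/-- The vectors obtained after `k` steps of the gliding hump construction. -/
def Stage (k : ℕ) : ArgKind 𝕜 w → LorentzPredual 𝕜 w → Prop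
  | .fixed v, x => x = v
  | .basis, x => (∀ᶠ i in atTop, x.seq i = 0) ∧
      ∀ A : Finset ℕ, ∑ i ∈ A, ‖x.seq i‖ ≤ w.W (min A.card k)
  | .tail, x => ‖x‖ < 2
  | .free, _ => False

/-- A set containing the new index has one old index fewer, and `‖c‖ ≤ w k` fits under the weight
that the extra index makes available, since `w` decreases. -/
theorem Stage.basis_add {k : ℕ} {x : LorentzPredual 𝕜 w} (hx : Stage k .basis x) {i : ℕ} {c : 𝕜}
    (hi : x.seq i = 0) (hc : ‖c‖ ≤ w.toFun k) : Stage (k + 1) .basis (x + c • unit 𝕜 w i) := by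
  refine ⟨?_, fun A => ?_⟩
  · filter_upwards [hx.1, eventually_gt_atTop i] with j hj hij
    simp [hj, seq_unit, hij.ne']
  · by_cases hiA : i ∈ A
    · have h1 : ∀ j ∈ A.erase i, ‖(x + c • unit 𝕜 w i).seq j‖ = ‖x.seq j‖ := fun j hj => by
        simp [seq_unit, Finset.ne_of_mem_erase hj]
      have h2 : ‖(x + c • unit 𝕜 w i).seq i‖ = ‖c‖ := by simp [hi]
      have hcard : A.card = (A.erase i).card + 1 := (Finset.card_erase_add_one hiA).symm
      rw [← Finset.add_sum_erase A _ hiA, Finset.sum_congr rfl h1, h2, hcard,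
        Nat.add_min_add_right, w.W_succ]
      have h3 : w.toFun k ≤ w.toFun (min (A.erase i).card k) := w.antitone (min_le_right _ _)
      linarith [hx.2 (A.erase i)]
    · have h1 : ∀ j ∈ A, ‖(x + c • unit 𝕜 w i).seq j‖ = ‖x.seq j‖ := fun j hj => by
        have : j ≠ i := fun h => hiA (h ▸ hj)
        simp [seq_unit, this]
      rw [Finset.sum_congr rfl h1]
      exact (hx.2 A).trans (w.W_mono (min_le_min_left _ k.le_succ))

/-- The bound does not depend on `k`: this is what a growing form will contradict. -/
theorem Stage.exists_norm_le (κ : ArgKind 𝕜 w) : ∃ B : ℝ, ∀ k x, Stage k κ x → ‖x‖ ≤ B := by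
  cases κ with
  | fixed v => exact ⟨‖v‖, fun k x hx => by rw [show x = v from hx]⟩
  | basis => exact ⟨1, fun k x hx => norm_le_of_sum_le fun A => by
      rw [one_mul]
      exact (hx.2 A).trans (w.W_mono (min_le_left _ _))⟩
  | tail => exact ⟨2, fun k x hx => le_of_lt hx⟩
  | free => exact ⟨0, fun k x hx => hx.elim⟩

theorem exists_norm_add_mul_eq (a b : 𝕜) : ∃ c : 𝕜, ‖c‖ = 1 ∧ ‖a + c * b‖ = ‖a‖ + ‖b‖ := by
  by_cases ha : a = 0
  · exact ⟨1, by simp, by simp [ha]⟩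
  by_cases hb : b = 0
  · exact ⟨1, by simp, by simp [hb]⟩
  have ha' : (‖a‖ : 𝕜) ≠ 0 := by simpa using ha
  have hb' : (‖b‖ : 𝕜) ≠ 0 := by simpa using hb
  have hna : ‖a‖ ≠ 0 := by simpa using ha
  have hnb : ‖b‖ ≠ 0 := by simpa using hb
  refine ⟨a / ‖a‖ * (‖b‖ / b), by simp [hna, hnb], ?_⟩
  have : a + a / ‖a‖ * (‖b‖ / b) * b = a / ‖a‖ * ((‖a‖ + ‖b‖ : ℝ) : 𝕜) := by
    push_cast
    field_simp
  rw [this, norm_mul, norm_div, RCLike.norm_ofReal, RCLike.norm_ofReal, abs_norm, div_self hna,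
    one_mul, abs_of_nonneg (by positivity)]

end LorentzPredual

/-! ### The gliding hump: forms vanish at infinity when `w ∉ ℓ_N` -/

namespace LorentzPredual

/-- Bounds the loss from scaling the basis arguments by `r = w k`: at most `N` arguments are scaled.
-/
theorem pow_le_prod {ι : Type*} [Fintype ι] {T : Finset ι} {N : ℕ} (hT : T.card ≤ N) {r : ℝ}
    (hr0 : 0 ≤ r) (hr1 : r ≤ 1) {b : ι → ℝ} (hb : ∀ j, r ≤ b j) (hb1 : ∀ j ∉ T, b j = 1) :
    r ^ N ≤ ∏ j, b j :=
  calc r ^ N ≤ r ^ T.card := pow_le_pow_of_le_one hr0 hr1 hT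
    _ = ∏ _j ∈ T, r := by simp
    _ ≤ ∏ j ∈ T, b j := Finset.prod_le_prod (fun _ _ => hr0) fun j _ => hb j
    _ = ∏ j, b j := Finset.prod_subset (Finset.subset_univ T) fun j _ => hb1 j

variable {𝕜 : Type*} [RCLike 𝕜] {w : AdmissibleSequence}
  {ι : Type*} [DecidableEq ι] [Fintype ι]
  {Φ : ContinuousMultilinearMap 𝕜 (fun _ : ι => LorentzPredual 𝕜 w) 𝕜}
  {κ : ι → ArgKind 𝕜 w}

/-- One step of the gliding hump construction. -/
theorem exists_stage_succ {T : Finset ι} {N : ℕ} (hT : T.card ≤ N)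
    (hκT : ∀ j ∉ T, (κ j).weight = 0) (hmov : ∃ j, (κ j).Moving) {ε : ℝ} (hε : 0 < ε)
    (hfar : ∀ δ > 0, ∃ᶠ m in atTop, ∃ z : ι → LorentzPredual 𝕜 w, (∀ j, (κ j).Allowed m (z j)) ∧
      (∀ j, κ j = .tail → ∀ i, ‖(z j).seq i‖ ≤ δ) ∧ 2 * ε ≤ ‖Φ z‖)
    (hmix : ∀ (s : Finset ι) (v : ι → LorentzPredual 𝕜 w), (∃ j ∈ s, (κ j).Moving) →
      (∃ j ∉ s, (κ j).Moving) → Vanishes Φ (s.piecewise (fun j => .fixed (v j)) κ))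
    {k : ℕ} {V : ι → LorentzPredual 𝕜 w} (hV : ∀ j, Stage k (κ j) (V j)) :
    ∃ V' : ι → LorentzPredual 𝕜 w, (∀ j, Stage (k + 1) (κ j) (V' j)) ∧
      ‖Φ V‖ + ε * w.toFun k ^ N ≤ ‖Φ V'‖ := by
  classical
  have hwk := w.toFun_pos k
  set C : ℝ := ((Fintype.card (Finset ι) : ℕ) : ℝ) with hC
  have hCpos : 0 < C := by
    rw [hC]
    exact_mod_cast Fintype.card_pos
  set NF : Finset ι := Finset.univ.filter fun j => (κ j).Moving with hNF
  have hmemNF : ∀ j, j ∈ NF ↔ (κ j).Moving := fun j => by simp [hNF]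
  -- The strict bound `‖V j‖ < 2` leaves slack, so a tail block of small enough supremum norm can be
  -- added without scaling it down.
  obtain ⟨δ, hδ, hδV⟩ : ∃ δ > 0, ∀ j, κ j = .tail → ∀ t : LorentzPredual 𝕜 w, ‖t‖ ≤ 1 →
      (∀ i, ‖t.seq i‖ ≤ δ) → ‖V j + t‖ < 2 := by
    have h1 : ∀ j, ∀ᶠ δ in 𝓝[>] (0 : ℝ), κ j = .tail → ∀ t : LorentzPredual 𝕜 w, ‖t‖ ≤ 1 →
        (∀ i, ‖t.seq i‖ ≤ δ) → ‖V j + t‖ < 2 := fun j => by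
      by_cases hj : κ j = .tail
      · have hVj := hV j
        rw [hj] at hVj
        have hVj2 : max ‖V j‖ 1 < 2 := max_lt hVj (by norm_num)
        obtain ⟨δ, hδ, h⟩ := exists_forall_norm_add_le (V j) (half_pos (sub_pos.2 hVj2))
        filter_upwards [Ioc_mem_nhdsGT hδ] with δ' hδ' _ t ht hti
        have := h t ht fun i => (hti i).trans hδ'.2
        linarith
      · exact Eventually.of_forall fun m h => absurd h hj
    obtain ⟨δ, hδ1, hδ2⟩ := ((eventually_all.2 h1).and self_mem_nhdsWithin).exists
    exact ⟨δ, hδ2, hδ1⟩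
  -- In a mixed term some moving arguments are frozen at `V` and others still move. The vectors `V`
  -- are known before `m`, so the tolerance may depend on them and on `k`.
  have hmix' : ∀ᶠ m in atTop, ∀ s : Finset ι, s ⊆ NF → s ≠ ∅ → s ≠ NF →
      ∀ z : ι → LorentzPredual 𝕜 w,
      (∀ j, (s.piecewise (fun j => .fixed (V j)) κ j).Allowed m (z j)) →
        ‖Φ z‖ ≤ ε * w.toFun k ^ N / C := by
    refine eventually_all.2 fun s => ?_
    by_cases hs : s ⊆ NF ∧ s ≠ ∅ ∧ s ≠ NF
    · obtain ⟨j, hj⟩ := Finset.nonempty_iff_ne_empty.2 hs.2.1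
      obtain ⟨i, hi, his⟩ := Finset.exists_of_ssubset (hs.1.ssubset_of_ne hs.2.2)
      filter_upwards [hmix s V ⟨j, hj, (hmemNF j).1 (hs.1 hj)⟩ ⟨i, his, (hmemNF i).1 hi⟩
        (ε * w.toFun k ^ N / C) (by positivity)] with m hm _ _ _ using hm
    · exact Eventually.of_forall fun m h1 h2 h3 => absurd ⟨h1, h2, h3⟩ hs
  have hsupp : ∀ᶠ m in atTop, ∀ j, κ j = .basis → ∀ i ≥ m, (V j).seq i = 0 := by
    refine eventually_all.2 fun j => ?_
    by_cases hj : κ j = .basis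
    · have hVj := hV j
      rw [hj] at hVj
      filter_upwards [eventually_forall_ge_atTop.2 hVj.1] with m hm _ using hm
    · exact Eventually.of_forall fun m h => absurd h hj
  obtain ⟨m, ⟨z, hz, hzδ, hzΦ⟩, hm1, hm2⟩ := ((hfar δ hδ).and_eventually (hmix'.and hsupp)).exists
  obtain ⟨j₀, hj₀⟩ := hmov
  -- Only basis blocks are shrunk, to fit the weight `w k`; tail blocks keep their size.
  set b : ι → ℝ := fun j => if κ j = .basis then w.toFun k else 1 with hb
  have hb0 : ∀ j, 0 ≤ b j := fun j => by simp only [hb]; split_ifs <;> linarith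
  have hb1 : ∀ j, b j ≤ 1 := fun j => by
    simp only [hb]; split_ifs <;> linarith [w.toFun_le_one k]
  have hbk : ∀ j, w.toFun k ≤ b j := fun j => by
    simp only [hb]; split_ifs <;> linarith [w.toFun_le_one k]
  set y : ι → LorentzPredual 𝕜 w := fun j => (b j : 𝕜) • z j with hy
  have hΦy : 2 * (ε * w.toFun k ^ N) ≤ ‖Φ y‖ := by
    rw [hy, Φ.map_smul_univ, norm_smul, norm_prod]
    simp only [RCLike.norm_ofReal, abs_of_nonneg (hb0 _)]
    have := pow_le_prod hT hwk.le (w.toFun_le_one k) hbk fun j hj => by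
      have hjb : κ j ≠ .basis := fun h => by simpa [h, ArgKind.weight] using hκT j hj
      simp [hb, hjb]
    have h0 : 0 < w.toFun k ^ N := by positivity
    nlinarith
  obtain ⟨c, hc, hcΦ⟩ := exists_norm_add_mul_eq (Φ V) (Φ y)
  -- The phase aligning the new value with `Φ V` is put on a single moving argument, so that it
  -- multiplies `Φ y` exactly once.
  set a : ι → 𝕜 := fun j => if j = j₀ then c * b j else b j with ha
  have hab : ∀ j, ‖a j‖ ≤ b j := fun j => by
    simp only [ha]
    split_ifs <;> simp [hc, abs_of_nonneg (hb0 j)]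
  set u : ι → LorentzPredual 𝕜 w := fun j => a j • z j with hu
  have hΦu : Φ u = c * Φ y := by
    have : u = Function.update y j₀ (c • y j₀) := by
      funext j
      by_cases hj : j = j₀
      · subst hj
        simp [hu, hy, ha, smul_smul]
      · simp [hu, hy, ha, hj]
    rw [this, Φ.map_update_smul, Function.update_eq_self, smul_eq_mul]
  have hfixed : ∀ j, ¬ (κ j).Moving → u j = V j := fun j hj => by
    have h1 : a j = 1 := by
      have hjj : j ≠ j₀ := fun h => hj (h ▸ hj₀)
      have hjb : κ j ≠ .basis := fun h => hj (by rw [h]; trivial)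
      simp [ha, hb, hjj, hjb]
    have hzj := hz j
    have hVj := hV j
    simp only [hu, h1, one_smul]
    revert hzj hVj hj
    cases κ j with
    | fixed v => exact fun _ h1 h2 => Eq.trans h1 (Eq.symm h2)
    | basis => exact fun h => absurd trivial h
    | tail => exact fun h => absurd trivial h
    | free => exact fun _ _ h => h.elim
  have huA : ∀ j, (κ j).Allowed m (u j) := fun j => by
    by_cases hj : (κ j).Moving
    · exact (hz j).smul ((hab j).trans (hb1 j)) hj
    · have hVj := hV j
      rw [hfixed j hj]
      revert hVj hj
      cases κ j with
      | fixed v => exact fun _ h => h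
      | basis => exact fun h => absurd trivial h
      | tail => exact fun h => absurd trivial h
      | free => exact fun _ h => h.elim
  refine ⟨NF.piecewise (V + u) u, fun j => ?_, ?_⟩
  · by_cases hj : (κ j).Moving
    · rw [Finset.piecewise_eq_of_mem _ _ _ ((hmemNF j).2 hj), Pi.add_apply]
      have hVj := hV j
      have hzj := hz j
      cases hκj : κ j with
      | fixed v => rw [hκj] at hj; exact hj.elim
      | free => rw [hκj] at hj; exact hj.elim
      | basis =>
        rw [hκj] at hVj hzj
        obtain ⟨d, i, hd, hi, hzi⟩ := hzj
        have huj : u j = (a j * d) • unit 𝕜 w i := by simp only [hu, hzi, smul_smul]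
        rw [huj]
        refine hVj.basis_add (hm2 j hκj i hi) ?_
        rw [norm_mul]
        have hbj : b j = w.toFun k := by simp [hb, hκj]
        exact (mul_le_of_le_one_right (norm_nonneg _) hd).trans ((hab j).trans_eq hbj)
      | tail =>
        have h1 := (huA j)
        rw [hκj] at h1
        refine hδV j hκj _ h1.1 fun i => ?_
        simp only [hu, seq_smul_apply, norm_mul]
        exact (mul_le_of_le_one_left (norm_nonneg _) ((hab j).trans (hb1 j))).trans (hzδ j hκj i)
    · rw [Finset.piecewise_eq_of_notMem _ _ _ (fun h => hj ((hmemNF j).1 h)), hfixed j hj]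
      have hVj := hV j
      revert hVj hj
      cases κ j with
      | fixed v => exact fun _ h => h
      | basis => exact fun h => absurd trivial h
      | tail => exact fun h => absurd trivial h
      | free => exact fun _ h => h.elim
  · have hne : NF ≠ ∅ := Finset.nonempty_iff_ne_empty.1 ⟨j₀, (hmemNF j₀).2 hj₀⟩
    have hVu : NF.piecewise V u = V := by
      funext j
      by_cases hj : j ∈ NF
      · simp [hj]
      · simp [hj, hfixed j fun h => hj ((hmemNF j).2 h)]
    have hmem1 : ∅ ∈ NF.powerset.erase NF :=
      Finset.mem_erase.2 ⟨hne.symm, Finset.mem_powerset.2 (Finset.empty_subset _)⟩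
    -- The extreme terms are `Φ V` and `c * Φ y`, aligned and together at least `‖Φ V‖ + 2 * ε * w k
    -- ^ N`; the mixed terms take away at most `ε * w k ^ N`.
    rw [Φ.map_piecewise_add, ← Finset.add_sum_erase _ _ (Finset.mem_powerset_self NF),
      ← Finset.add_sum_erase _ _ hmem1, hVu, Finset.piecewise_empty, hΦu, ← add_assoc]
    have hrest : ‖∑ s ∈ (NF.powerset.erase NF).erase ∅, Φ (s.piecewise V u)‖
        ≤ ε * w.toFun k ^ N := by
      refine (norm_sum_le_of_le (n := fun _ => ε * w.toFun k ^ N / C) _ fun s hs => ?_).trans ?_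
      · simp only [Finset.mem_erase, Finset.mem_powerset] at hs
        refine hm1 s hs.2.2 hs.1 hs.2.1 _ fun j => ?_
        by_cases hj : j ∈ s
        · simp only [hj, Finset.piecewise_eq_of_mem]
          rfl
        · simpa [hj] using huA j
      · rw [Finset.sum_const, nsmul_eq_mul, mul_div_assoc', div_le_iff₀ hCpos, mul_comm]
        refine mul_le_mul_of_nonneg_left ?_ (by positivity)
        rw [hC]
        exact_mod_cast Finset.card_le_univ _
    have h2 := norm_sub_le_norm_add (Φ V + c * Φ y)
      (∑ s ∈ (NF.powerset.erase NF).erase ∅, Φ (s.piecewise V u))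
    linarith

/-- A form for which the gliding hump construction works is unbounded, as `w ∉ ℓ_N`. -/
theorem vanishes_of_no_free {T : Finset ι} {N : ℕ} (hT : T.card ≤ N)
    (hw : ¬ Summable fun i => w.toFun i ^ N) (hκT : ∀ j ∉ T, (κ j).weight = 0) (hfree : ∀ j, κ j ≠ .free)
    (hmov : ∃ j, (κ j).Moving)
    (htail : ∀ j, κ j = .tail → Vanishes Φ (Function.update κ j .basis))
    (hmix : ∀ (s : Finset ι) (v : ι → LorentzPredual 𝕜 w), (∃ j ∈ s, (κ j).Moving) →
      (∃ j ∉ s, (κ j).Moving) → Vanishes Φ (s.piecewise (fun j => .fixed (v j)) κ)) :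
    Vanishes Φ κ := by
  by_contra hcon
  obtain ⟨ε, hε, hev⟩ : ∃ ε > 0, ∃ᶠ m in atTop, ∃ z : ι → LorentzPredual 𝕜 w,
      (∀ j, (κ j).Allowed m (z j)) ∧ ε < ‖Φ z‖ := by
    unfold Vanishes at hcon
    push Not at hcon
    exact hcon
  -- Discarding large coordinates costs `ε / 2`, so `ε / 2 = 2 * (ε / 4)` survives.
  have hfar : ∀ δ > 0, ∃ᶠ m in atTop, ∃ z : ι → LorentzPredual 𝕜 w,
      (∀ j, (κ j).Allowed m (z j)) ∧ (∀ j, κ j = .tail → ∀ i, ‖(z j).seq i‖ ≤ δ) ∧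
        2 * (ε / 4) ≤ ‖Φ z‖ := fun δ hδ => by
    refine (hev.and_eventually (exists_small_tails htail hδ (half_pos hε))).mono ?_
    rintro m ⟨⟨z, hz, hzε⟩, hm⟩
    obtain ⟨z', hz', hz'δ, hle⟩ := hm z hz
    exact ⟨z', hz', hz'δ, by linarith⟩
  have hstage : ∀ k, ∃ V : ι → LorentzPredual 𝕜 w, (∀ j, Stage k (κ j) (V j)) ∧
      ε / 4 * ∑ i ∈ Finset.range k, w.toFun i ^ N ≤ ‖Φ V‖ := fun k => by
    induction k with
    | zero =>
      have h0 : ∀ j, ∃ x, Stage 0 (κ j) x := fun j => by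
        cases hκj : κ j with
        | fixed v => exact ⟨v, rfl⟩
        | basis => exact ⟨0, Eventually.of_forall fun _ => rfl, fun A => by simp [w.W_zero]⟩
        | tail => exact ⟨0, by simp [Stage]⟩
        | free => exact absurd hκj (hfree j)
      choose V hV using h0
      exact ⟨V, hV, by simp⟩
    | succ k ih =>
      obtain ⟨V, hV, hle⟩ := ih
      obtain ⟨V', hV', hle'⟩ :=
        exists_stage_succ hT hκT hmov (by positivity : 0 < ε / 4) hfar hmix hV
      refine ⟨V', hV', ?_⟩
      rw [Finset.sum_range_succ, mul_add]
      linarith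
  choose B hB using fun j => Stage.exists_norm_le (κ j)
  have hbdd : ∀ k, ∑ i ∈ Finset.range k, w.toFun i ^ N ≤ ‖Φ‖ * (∏ j, B j) / (ε / 4) := fun k => by
    obtain ⟨V, hV, hle⟩ := hstage k
    rw [le_div_iff₀' (by positivity)]
    refine hle.trans ((Φ.le_opNorm V).trans ?_)
    exact mul_le_mul_of_nonneg_left
      (Finset.prod_le_prod (fun _ _ => norm_nonneg _) fun j _ => hB j k _ (hV j)) (norm_nonneg _)
  have htop := (not_summable_iff_tendsto_nat_atTop_of_nonneg
    fun i => pow_nonneg (w.nonneg i) N).1 hw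
  obtain ⟨k, hk⟩ := (htop.eventually (eventually_gt_atTop (‖Φ‖ * (∏ j, B j) / (ε / 4)))).exists
  exact absurd (hbdd k) (not_le.2 hk)

/-- If `w ∉ ℓ_N`, then a continuous form on `d_*(w,1)` vanishes at infinity along any kinds
of arguments of which at least one is moving and at most `N` are not fixed. -/
theorem vanishes_of_not_summable {T : Finset ι} {N : ℕ} (hT : T.card ≤ N)
    (hw : ¬ Summable fun i => w.toFun i ^ N)
    (Φ : ContinuousMultilinearMap 𝕜 (fun _ : ι => LorentzPredual 𝕜 w) 𝕜)
    (κ : ι → ArgKind 𝕜 w) (hκT : ∀ j ∉ T, (κ j).weight = 0)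
    (hmov : ∃ j, (κ j).Moving) : Vanishes Φ κ := by
  -- Each reduction lowers the total weight: free to tail or fixed, tail to basis, and moving to
  -- fixed in mixed terms. Arguments outside `T` stay fixed throughout, so the bound `N` is kept.
  induction hn : ∑ j, (κ j).weight using Nat.strong_induction_on generalizing κ with
  | _ n ih =>
    have hupd : ∀ (j : ι) (κ' : ArgKind 𝕜 w), κ'.weight < (κ j).weight →
        (∃ i, (Function.update κ j κ' i).Moving) → Vanishes Φ (Function.update κ j κ') := by
      intro j κ' hlt hex
      refine ih _ ?_ _ (fun i hi => ?_) hex rfl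
      swap
      · by_cases hij : i = j
        · subst hij
          have := hκT i hi
          omega
        · simpa [hij] using hκT i hi
      rw [← hn]
      refine Finset.sum_lt_sum (fun i _ => ?_) ⟨j, Finset.mem_univ j, by simpa using hlt⟩
      by_cases hi : i = j
      · subst hi; simpa using hlt.le
      · simp [hi]
    by_cases hfree : ∃ j, κ j = .free
    · obtain ⟨j, hj⟩ := hfree
      refine vanishes_of_free hj (hupd j _ (by rw [hj]; simp [ArgKind.weight]) ⟨j, ?_⟩)
        fun i => hupd j _ (by rw [hj]; exact Nat.succ_pos _) ?_
      · simp [ArgKind.Moving]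
      · obtain ⟨i, hi⟩ := hmov
        have hij : i ≠ j := by
          rintro rfl
          rw [hj] at hi
          exact hi
        exact ⟨i, by simpa [hij] using hi⟩
    · push Not at hfree
      refine vanishes_of_no_free hT hw hκT hfree hmov (fun j hj => ?_) fun s v hs hs' => ?_
      · exact hupd j _ (by rw [hj]; simp [ArgKind.weight]) ⟨j, by simp [ArgKind.Moving]⟩
      · refine ih _ ?_ _ (fun i hi => ?_) ?_ rfl
        · rw [← hn]
          obtain ⟨j, hjs, hj⟩ := hs
          refine Finset.sum_lt_sum (fun i _ => ?_) ⟨j, Finset.mem_univ j, ?_⟩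
          · by_cases hi : i ∈ s
            · simp [hi, ArgKind.weight]
            · simp [hi]
          · simp only [hjs, Finset.piecewise_eq_of_mem]
            revert hj
            cases κ j <;> simp [ArgKind.weight, ArgKind.Moving]
        · by_cases his : i ∈ s
          · simp [his, ArgKind.weight]
          · simpa [his] using hκT i hi
        · obtain ⟨j, hjs, hj⟩ := hs'
          exact ⟨j, by simpa [hjs] using hj⟩

end LorentzPredual

/-! ### Composition, continuity and norms of polynomials -/

section Polynomials

variable {𝕜 : Type*} [RCLike 𝕜] {k : ℕ}
  {X : Type*} [NormedAddCommGroup X] [NormedSpace 𝕜 X]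
  {Y : Type*} [NormedAddCommGroup Y] [NormedSpace 𝕜 Y]
  {Z : Type*} [NormedAddCommGroup Z] [NormedSpace 𝕜 Z]

theorem comp_mem_homPolySubmodule (L : Y →L[𝕜] Z) {f : X → Y} (hf : f ∈ homPolySubmodule 𝕜 k X Y) :
    (fun x => L (f x)) ∈ homPolySubmodule 𝕜 k X Z := by
  obtain ⟨Φ, hΦ⟩ := hf
  exact ⟨L.compContinuousMultilinearMap Φ, fun x => by simp [hΦ]⟩

theorem homPolySubmodule_comp (T : X →L[𝕜] Y) {f : Y → Z} (hf : f ∈ homPolySubmodule 𝕜 k Y Z) :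
    (fun x => f (T x)) ∈ homPolySubmodule 𝕜 k X Z := by
  obtain ⟨Φ, hΦ⟩ := hf
  exact ⟨Φ.compContinuousLinearMap fun _ => T, fun x => by simp [hΦ]⟩

theorem comp_mem_polySubmodule (L : Y →L[𝕜] Z) {f : X → Y} (hf : f ∈ polySubmodule 𝕜 k X Y) :
    (fun x => L (f x)) ∈ polySubmodule 𝕜 k X Z := by
  obtain ⟨P, hP, hf⟩ := hf
  exact ⟨fun j x => L (P j x), fun j => comp_mem_homPolySubmodule L (hP j), fun x => by simp [hf]⟩

theorem polySubmodule_comp (T : X →L[𝕜] Y) {f : Y → Z} (hf : f ∈ polySubmodule 𝕜 k Y Z) :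
    (fun x => f (T x)) ∈ polySubmodule 𝕜 k X Z := by
  obtain ⟨P, hP, hf⟩ := hf
  exact ⟨fun j x => P j (T x), fun j => homPolySubmodule_comp T (hP j), fun x => by simp [hf]⟩

theorem continuous_of_mem_polySubmodule {f : X → Y} (hf : f ∈ polySubmodule 𝕜 k X Y) :
    Continuous f := by
  obtain ⟨P, hP, hf⟩ := hf
  choose Φ hΦ using hP
  have : f = fun x => ∑ j ∈ Finset.range (k + 1), Φ j fun _ => x := by
    funext x
    simp [hf, hΦ]
  rw [this]
  fun_prop

theorem exists_lt_norm_of_lt_ballNorm {f : X → Y} {r : ℝ} (h : r < ballNorm f) :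
    ∃ x, ‖x‖ ≤ 1 ∧ r < ‖f x‖ := by
  have : Nonempty (Metric.closedBall (0 : X) 1) := ⟨⟨0, by simp⟩⟩
  obtain ⟨x, hx⟩ := exists_lt_of_lt_ciSup h
  exact ⟨x.1, mem_closedBall_zero_iff.1 x.2, hx⟩

theorem ballNorm_eq_of_forall_le {f : X → Y} {x₀ : X} (hx₀ : ‖x₀‖ ≤ 1)
    (h : ∀ x, ‖x‖ ≤ 1 → ‖f x‖ ≤ ‖f x₀‖) : ballNorm f = ‖f x₀‖ :=
  le_antisymm (ballNorm_le h) (le_ciSup (f := fun x : Metric.closedBall (0 : X) 1 => ‖f x‖)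
    ⟨‖f x₀‖, by rintro _ ⟨x, rfl⟩; exact h x.1 (mem_closedBall_zero_iff.1 x.2)⟩
    ⟨x₀, mem_closedBall_zero_iff.2 hx₀⟩)

end Polynomials

/-! ### Coordinates of `c₀` -/

section NullSequences

variable (𝕜 : Type*) [RCLike 𝕜]

variable {𝕜} in
theorem ZeroAtInftyContinuousMap.norm_apply_le (f : C₀(ℕ, 𝕜)) (m : ℕ) : ‖f m‖ ≤ ‖f‖ :=
  f.toBCF.norm_coe_le_norm m

variable {𝕜} in
theorem ZeroAtInftyContinuousMap.norm_le_of_forall {f : C₀(ℕ, 𝕜)} {C : ℝ}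
    (h : ∀ m, ‖f m‖ ≤ C) : ‖f‖ ≤ C :=
  (BoundedContinuousFunction.norm_le ((norm_nonneg _).trans (h 0))).2 h

/-- The coordinate functionals of `c₀`. -/
noncomputable def nullSeqCoord (m : ℕ) : C₀(ℕ, 𝕜) →L[𝕜] 𝕜 :=
  LinearMap.mkContinuous
    { toFun := fun f => f m
      map_add' := fun _ _ => rfl
      map_smul' := fun _ _ => rfl } 1 fun f => by
    rw [one_mul]
    exact f.norm_apply_le m

@[simp]
theorem nullSeqCoord_apply (m : ℕ) (f : C₀(ℕ, 𝕜)) : nullSeqCoord 𝕜 m f = f m := rfl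

/-- The embedding of the scalars as the `m`-th coordinate axis of `c₀`. -/
noncomputable def nullSeqSingle (m : ℕ) : 𝕜 →L[𝕜] C₀(ℕ, 𝕜) :=
  LinearMap.mkContinuous
    { toFun := fun c =>
        { toFun := fun i => if i = m then c else 0
          continuous_toFun := continuous_of_discreteTopology
          zero_at_infty' := by
            rw [cocompact_eq_cofinite]
            refine tendsto_nhds_of_eventually_eq ?_
            filter_upwards [(Set.finite_singleton m).compl_mem_cofinite] with i hi
            exact if_neg hi }
      map_add' := fun a b => ZeroAtInftyContinuousMap.ext fun i => by
        change (if i = m then a + b else 0) = (if i = m then a else 0) + if i = m then b else 0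
        split_ifs <;> simp
      map_smul' := fun a b => ZeroAtInftyContinuousMap.ext fun i => by
        change (if i = m then a * b else 0) = a * if i = m then b else 0
        split_ifs <;> simp } 1 fun c => by
    refine ZeroAtInftyContinuousMap.norm_le_of_forall fun i => ?_
    change ‖if i = m then c else 0‖ ≤ _
    split_ifs <;> simp

theorem nullSeqSingle_apply (m : ℕ) (c : 𝕜) (i : ℕ) :
    nullSeqSingle 𝕜 m c i = if i = m then c else 0 := rfl

end NullSequences

/-! ### Truncation and density when `w ∉ ℓ_N` -/

namespace LorentzPredual

variable {𝕜 : Type*} [RCLike 𝕜] {w : AdmissibleSequence}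

/-- If `w ∉ ℓ_N`, then forms of degree at most `N` are uniformly approximated by their
truncations. -/
theorem eventually_norm_form_sub_restrict_le {j N : ℕ} (hj : j ≤ N)
    (hw : ¬ Summable fun i => w.toFun i ^ N)
    (Φ : ContinuousMultilinearMap 𝕜 (fun _ : Fin j => LorentzPredual 𝕜 w) 𝕜) {ε : ℝ} (hε : 0 < ε) :
    ∀ᶠ n in atTop, ∀ x : LorentzPredual 𝕜 w, ‖x‖ ≤ 1 →
      ‖(Φ fun _ => x) - Φ fun _ => restrict (Set.Iio n) x‖ ≤ ε := by
  set C : ℝ := ((Fintype.card (Finset (Fin j)) : ℕ) : ℝ) with hC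
  have hCpos : 0 < C := by
    rw [hC]
    exact_mod_cast Fintype.card_pos
  -- Every term of the expansion other than the truncated one has a tail argument. The truncations
  -- depend on `n`, so they count as free rather than fixed.
  have hev : ∀ᶠ n in atTop, ∀ s : Finset (Fin j), s ≠ Finset.univ →
      ∀ z : Fin j → LorentzPredual 𝕜 w,
      (∀ i, (s.piecewise (fun _ => ArgKind.free) (fun _ => .tail) i).Allowed n (z i)) →
        ‖Φ z‖ ≤ ε / C := by
    refine eventually_all.2 fun s => ?_
    by_cases hs : s = Finset.univ
    · exact Eventually.of_forall fun n h => absurd hs h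
    · obtain ⟨i, hi⟩ : ∃ i, i ∉ s := by
        by_contra! h
        exact hs (Finset.eq_univ_of_forall h)
      filter_upwards [vanishes_of_not_summable (T := Finset.univ) (by simpa using hj) hw Φ
        (s.piecewise (fun _ => ArgKind.free) (fun _ => .tail)) (by simp)
        ⟨i, by simp [hi, ArgKind.Moving]⟩ (ε / C) (by positivity)] with n hn _ using hn
  filter_upwards [hev] with n hn x hx
  have hx_eq : (fun _ : Fin j => x) =
      (fun _ => restrict (Set.Iio n) x) + fun _ => restrict (Set.Iio n)ᶜ x := by
    funext i
    exact (restrict_add_restrict_compl _ x).symm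
  rw [hx_eq, Φ.map_add_univ, ← Finset.add_sum_erase _ _ (Finset.mem_univ Finset.univ),
    Finset.piecewise_univ, add_sub_cancel_left]
  refine (norm_sum_le_of_le (n := fun _ => ε / C) _ fun s hs => ?_).trans ?_
  · refine hn s (Finset.ne_of_mem_erase hs) _ fun i => ?_
    by_cases hi : i ∈ s
    · simp only [hi, Finset.piecewise_eq_of_mem]
      exact (norm_restrict_le _ _).trans hx
    · simp only [hi, not_false_eq_true, Finset.piecewise_eq_of_notMem]
      exact ⟨(norm_restrict_le _ _).trans hx, fun l hl => by simp [seq_restrict, hl]⟩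
  · rw [Finset.sum_const, nsmul_eq_mul, mul_div_assoc', div_le_iff₀ hCpos, mul_comm]
    refine mul_le_mul_of_nonneg_left ?_ hε.le
    rw [hC]
    exact_mod_cast Finset.card_le_univ _

theorem exists_norm_sub_restrict_le {N : ℕ} (hw : ¬ Summable fun i => w.toFun i ^ N)
    {f : LorentzPredual 𝕜 w → 𝕜} (hf : f ∈ polySubmodule 𝕜 N (LorentzPredual 𝕜 w) 𝕜)
    {ε : ℝ} (hε : 0 < ε) :
    ∃ n, ∀ x : LorentzPredual 𝕜 w, ‖x‖ ≤ 1 → ‖f x - f (restrict (Set.Iio n) x)‖ ≤ ε := by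
  obtain ⟨P, hP, hf⟩ := hf
  choose Φ hΦ using hP
  have hε' : 0 < ε / (N + 1) := by positivity
  obtain ⟨n, hn⟩ := ((Finset.range (N + 1)).eventually_all.2 fun j hj =>
    eventually_norm_form_sub_restrict_le (by simpa [Nat.lt_succ_iff] using hj) hw (Φ j) hε').exists
  refine ⟨n, fun x hx => ?_⟩
  rw [hf, hf, ← Finset.sum_sub_distrib]
  refine (norm_sum_le_of_le (n := fun _ => ε / (N + 1)) _ fun j hj => ?_).trans ?_
  · rw [hΦ, hΦ]
    exact hn j hj x hx
  · rw [Finset.sum_const, Finset.card_range, nsmul_eq_mul, mul_div_assoc',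
      div_le_iff₀ (by positivity)]
    push_cast
    linarith

/-- A continuous function of finitely many coordinates attains its maximum modulus on the unit
ball. -/
theorem exists_forall_norm_restrict_le {f : LorentzPredual 𝕜 w → 𝕜} (hf : Continuous f) (n : ℕ) :
    ∃ x₀ : LorentzPredual 𝕜 w, ‖x₀‖ ≤ 1 ∧ ∀ x : LorentzPredual 𝕜 w, ‖x‖ ≤ 1 →
      ‖f (restrict (Set.Iio n) x)‖ ≤ ‖f (restrict (Set.Iio n) x₀)‖ := by
  set L : (Fin n → 𝕜) → LorentzPredual 𝕜 w := fun a => ∑ i, a i • unit 𝕜 w i with hL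
  have hLc : Continuous L := by fun_prop
  have hLx : ∀ x : LorentzPredual 𝕜 w, L (fun i => x.seq i) = restrict (Set.Iio n) x := fun x => by
    rw [restrict_Iio, hL, Finset.sum_range fun i => x.seq i • unit 𝕜 w i]
  -- Coordinates of unit vectors have modulus at most `1`, so the box excludes no truncated vector
  -- and makes the domain bounded.
  have hcomp : IsCompact (Metric.closedBall (0 : Fin n → 𝕜) 1 ∩ L ⁻¹' Metric.closedBall 0 1) :=
    (isCompact_closedBall _ _).inter_right (Metric.isClosed_closedBall.preimage hLc)
  obtain ⟨a, ha, hmax⟩ := hcomp.exists_isMaxOn ⟨0, by simp [hL]⟩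
    (f := fun a => ‖f (L a)‖) (by fun_prop)
  refine ⟨L a, mem_closedBall_zero_iff.1 ha.2, fun x hx => ?_⟩
  have hLa : restrict (Set.Iio n) (L a) = L a := by
    rw [← hLx]
    congr 1
    funext i
    simp [hL, seq_unit, Fin.val_inj]
  rw [hLa, ← hLx]
  refine hmax ⟨?_, ?_⟩
  · rw [mem_closedBall_zero_iff, pi_norm_le_iff_of_nonneg zero_le_one]
    exact fun i => (x.norm_seq_le i).trans hx
  · rw [Set.mem_preimage, hLx, mem_closedBall_zero_iff]
    exact (norm_restrict_le _ _).trans hx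

/-- The perturbation of a `c₀`-valued map in which the `m`-th coordinate is replaced by a multiple
of its truncation. -/
noncomputable def replaceCoord (f : LorentzPredual 𝕜 w → C₀(ℕ, 𝕜)) (m n : ℕ) (c : 𝕜) :
    LorentzPredual 𝕜 w → C₀(ℕ, 𝕜) :=
  f + fun x => nullSeqSingle 𝕜 m
    (nullSeqCoord 𝕜 m (c • f (restrictL (Set.Iio n) x) - f x))

theorem replaceCoord_apply_self (f : LorentzPredual 𝕜 w → C₀(ℕ, 𝕜)) (m n : ℕ) (c : 𝕜)
    (x : LorentzPredual 𝕜 w) :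
    replaceCoord f m n c x m = c * f (restrict (Set.Iio n) x) m := by
  simp [replaceCoord, nullSeqSingle_apply]

theorem replaceCoord_apply_ne (f : LorentzPredual 𝕜 w → C₀(ℕ, 𝕜)) {m i : ℕ} (h : i ≠ m) (n : ℕ)
    (c : 𝕜) (x : LorentzPredual 𝕜 w) : replaceCoord f m n c x i = f x i := by
  simp [replaceCoord, nullSeqSingle_apply, h]

theorem replaceCoord_mem_homPolySubmodule {N : ℕ} {f : LorentzPredual 𝕜 w → C₀(ℕ, 𝕜)}
    (hf : f ∈ homPolySubmodule 𝕜 N (LorentzPredual 𝕜 w) C₀(ℕ, 𝕜)) (m n : ℕ) (c : 𝕜) :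
    replaceCoord f m n c ∈ homPolySubmodule 𝕜 N (LorentzPredual 𝕜 w) C₀(ℕ, 𝕜) :=
  Submodule.add_mem _ hf (comp_mem_homPolySubmodule (nullSeqSingle 𝕜 m)
    (comp_mem_homPolySubmodule (nullSeqCoord 𝕜 m) (Submodule.sub_mem _
      (Submodule.smul_mem _ c (homPolySubmodule_comp (restrictL (Set.Iio n)) hf)) hf)))

theorem replaceCoord_mem_polySubmodule {N : ℕ} {f : LorentzPredual 𝕜 w → C₀(ℕ, 𝕜)}
    (hf : f ∈ polySubmodule 𝕜 N (LorentzPredual 𝕜 w) C₀(ℕ, 𝕜)) (m n : ℕ) (c : 𝕜) :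
    replaceCoord f m n c ∈ polySubmodule 𝕜 N (LorentzPredual 𝕜 w) C₀(ℕ, 𝕜) :=
  Submodule.add_mem _ hf (comp_mem_polySubmodule (nullSeqSingle 𝕜 m)
    (comp_mem_polySubmodule (nullSeqCoord 𝕜 m) (Submodule.sub_mem _
      (Submodule.smul_mem _ c (polySubmodule_comp (restrictL (Set.Iio n)) hf)) hf)))

/-- If `w ∉ ℓ_N`, every `c₀`-valued polynomial of degree at most `N` has norm attaining
perturbations. -/
theorem exists_replaceCoord_attaining {N : ℕ} (hw : ¬ Summable fun i => w.toFun i ^ N)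
    {f : LorentzPredual 𝕜 w → C₀(ℕ, 𝕜)}
    (hf : f ∈ polySubmodule 𝕜 N (LorentzPredual 𝕜 w) C₀(ℕ, 𝕜)) {ε : ℝ} (hε : 0 < ε) :
    ∃ (m n : ℕ) (c : 𝕜), ballNorm (replaceCoord f m n c - f) ≤ ε ∧
      ∃ x₀ : LorentzPredual 𝕜 w, ‖x₀‖ ≤ 1 ∧
        ‖replaceCoord f m n c x₀‖ = ballNorm (replaceCoord f m n c) := by
  set B := ballNorm f with hB
  have hfB : ∀ x : LorentzPredual 𝕜 w, ‖x‖ ≤ 1 → ‖f x‖ ≤ B := fun x hx => norm_le_ballNorm hf hx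
  have hB0 : 0 ≤ B := (norm_nonneg _).trans (hfB 0 (by simp))
  -- Enlarging the truncation by `1 + s` costs at most `s * B ≤ ε / 2`; the other `ε / 2` pays for
  -- truncating.
  set s : ℝ := ε / (2 * (B + 1)) with hs
  have hs0 : 0 < s := by positivity
  have hsB : s * B ≤ ε / 2 := by
    rw [hs, div_mul_eq_mul_div, div_le_div_iff₀ (by positivity) two_pos]
    nlinarith
  -- One `η` is lost in choosing an almost norming point and coordinate, the other in truncating;
  -- the factor `1 + s` must recover both.
  obtain ⟨η, hη0, hηε, hη⟩ : ∃ η > 0, η ≤ ε / 2 ∧ (B = 0 ∨ B ≤ (1 + s) * (B - 2 * η)) := by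
    rcases hB0.eq_or_lt with h | h
    · exact ⟨ε / 2, by positivity, le_rfl, Or.inl h.symm⟩
    · refine ⟨min (ε / 2) (s * B / (2 * (1 + s))), by positivity, min_le_left _ _, Or.inr ?_⟩
      have := min_le_right (ε / 2) (s * B / (2 * (1 + s)))
      rw [le_div_iff₀ (by positivity)] at this
      linarith
  obtain ⟨x₁, m, hx₁, hm⟩ : ∃ (x₁ : LorentzPredual 𝕜 w) (m : ℕ), ‖x₁‖ ≤ 1 ∧ B - η < ‖f x₁ m‖ := by
    obtain ⟨x₁, hx₁, h⟩ := exists_lt_norm_of_lt_ballNorm (f := f) (r := B - η) (by linarith)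
    by_contra! hcon
    exact absurd (ZeroAtInftyContinuousMap.norm_le_of_forall fun m => hcon x₁ m hx₁) (not_le.2 h)
  have hfm : (fun x => f x m) ∈ polySubmodule 𝕜 N (LorentzPredual 𝕜 w) 𝕜 :=
    comp_mem_polySubmodule (nullSeqCoord 𝕜 m) hf
  obtain ⟨n, hn⟩ := exists_norm_sub_restrict_le hw hfm hη0
  obtain ⟨x₀, hx₀, hmax⟩ :=
    exists_forall_norm_restrict_le (continuous_of_mem_polySubmodule hfm) n
  have hc : ‖((1 + s : ℝ) : 𝕜)‖ = 1 + s := by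
    rw [RCLike.norm_ofReal, abs_of_pos (by positivity)]
  -- The new coordinate `m` reaches at `x₀` at least the norm of `f`, so no unchanged coordinate can
  -- exceed it.
  have hBle : B ≤ (1 + s) * ‖f (restrict (Set.Iio n) x₀) m‖ := by
    rcases hη with h | h
    · rw [h]
      positivity
    · refine h.trans (mul_le_mul_of_nonneg_left ?_ (by positivity))
      have h1 := hmax x₁ hx₁
      have h2 := norm_sub_norm_le (f x₁ m) (f (restrict (Set.Iio n) x₁) m)
      have h3 := hn x₁ hx₁
      linarith
  refine ⟨m, n, ((1 + s : ℝ) : 𝕜), ballNorm_le fun x hx => ?_, x₀, hx₀,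
    (ballNorm_eq_of_forall_le hx₀ fun x hx => ?_).symm⟩
  · refine ZeroAtInftyContinuousMap.norm_le_of_forall fun i => ?_
    rw [Pi.sub_apply, ZeroAtInftyContinuousMap.sub_apply]
    by_cases hi : i = m
    · subst hi
      rw [replaceCoord_apply_self]
      have h1 : ((1 + s : ℝ) : 𝕜) * f (restrict (Set.Iio n) x) i - f x i =
          (s : 𝕜) * f (restrict (Set.Iio n) x) i - (f x i - f (restrict (Set.Iio n) x) i) := by
        push_cast
        ring
      rw [h1]
      refine (norm_sub_le _ _).trans ?_
      rw [norm_mul, RCLike.norm_ofReal, abs_of_pos hs0]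
      have h2 := hn x hx
      have h3 := ((f (restrict (Set.Iio n) x)).norm_apply_le i).trans
        (hfB _ ((norm_restrict_le _ _).trans hx))
      nlinarith
    · rw [replaceCoord_apply_ne f hi, sub_self, norm_zero]
      exact hε.le
  · have hx₀m := (replaceCoord f m n ((1 + s : ℝ) : 𝕜) x₀).norm_apply_le m
    rw [replaceCoord_apply_self, norm_mul, hc] at hx₀m
    refine ZeroAtInftyContinuousMap.norm_le_of_forall fun i => le_trans ?_ hx₀m
    by_cases hi : i = m
    · subst hi
      rw [replaceCoord_apply_self, norm_mul, hc]
      exact mul_le_mul_of_nonneg_left (hmax x hx) (by positivity)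
    · rw [replaceCoord_apply_ne f hi]
      exact (((f x).norm_apply_le i).trans (hfB x hx)).trans hBle

theorem dense_normAttaining_homPoly {N : ℕ} (hw : ¬ Summable fun i => w.toFun i ^ N) :
    Dense (HomPoly.normAttaining 𝕜 N (LorentzPredual 𝕜 w) C₀(ℕ, 𝕜)) := by
  refine Metric.dense_iff.2 fun P ε hε => ?_
  obtain ⟨m, n, c, hle, hatt⟩ := exists_replaceCoord_attaining hw P.mem_poly (half_pos hε)
  let Q : HomPoly 𝕜 N (LorentzPredual 𝕜 w) C₀(ℕ, 𝕜) := ⟨_, replaceCoord_mem_homPolySubmodule P.2 m n c⟩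
  have hQ : ‖Q - P‖ ≤ ε / 2 := hle
  refine ⟨Q, ?_, hatt⟩
  rw [Metric.mem_ball, dist_eq_norm]
  exact hQ.trans_lt (half_lt_self hε)

theorem dense_normAttaining_polyDegLE {N : ℕ} (hw : ¬ Summable fun i => w.toFun i ^ N) :
    Dense (PolyDegLE.normAttaining 𝕜 N (LorentzPredual 𝕜 w) C₀(ℕ, 𝕜)) := by
  refine Metric.dense_iff.2 fun P ε hε => ?_
  obtain ⟨m, n, c, hle, hatt⟩ := exists_replaceCoord_attaining hw P.2 (half_pos hε)
  let Q : PolyDegLE 𝕜 N (LorentzPredual 𝕜 w) C₀(ℕ, 𝕜) := ⟨_, replaceCoord_mem_polySubmodule P.2 m n c⟩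
  have hQ : ‖Q - P‖ ≤ ε / 2 := hle
  refine ⟨Q, ?_, hatt⟩
  rw [Metric.mem_ball, dist_eq_norm]
  exact hQ.trans_lt (half_lt_self hε)

end LorentzPredual

/-! ### Majorization of power sums -/

section Majorization

/-- Abel summation. The induction in `key` retains the boundary term, `b n` times the nonnegative
gap between the partial sums. -/
theorem sum_mul_le_sum_mul_of_antitone {a w b : ℕ → ℝ} (hb : Antitone b) (hb0 : ∀ i, 0 ≤ b i)
    (h : ∀ n, ∑ i ∈ Finset.range n, a i ≤ ∑ i ∈ Finset.range n, w i) (n : ℕ) :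
    ∑ i ∈ Finset.range n, a i * b i ≤ ∑ i ∈ Finset.range n, w i * b i := by
  have key : ∀ n, b n * (∑ i ∈ Finset.range n, w i - ∑ i ∈ Finset.range n, a i) ≤
      ∑ i ∈ Finset.range n, w i * b i - ∑ i ∈ Finset.range n, a i * b i := fun n => by
    induction n with
    | zero => simp
    | succ n ih =>
      have h1 := mul_le_mul_of_nonneg_right (hb n.le_succ) (sub_nonneg.2 (h (n + 1)))
      refine h1.trans ?_
      simp only [Finset.sum_range_succ]
      linarith
  have h2 := mul_nonneg (hb0 n) (sub_nonneg.2 (h n))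
  linarith [key n]

/-- Factors `a` are exchanged for `w` one at a time, the remaining product `a ^ p * w ^ q` being the
decreasing weight of the previous lemma. -/
theorem sum_pow_le_sum_pow_of_antitone {a w : ℕ → ℝ} (ha : Antitone a) (ha0 : ∀ i, 0 ≤ a i)
    (hw : Antitone w) (hw0 : ∀ i, 0 ≤ w i)
    (h : ∀ n, ∑ i ∈ Finset.range n, a i ≤ ∑ i ∈ Finset.range n, w i) (p n : ℕ) :
    ∑ i ∈ Finset.range n, a i ^ p ≤ ∑ i ∈ Finset.range n, w i ^ p := by
  have key : ∀ p q : ℕ, ∑ i ∈ Finset.range n, a i ^ p * w i ^ q ≤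
      ∑ i ∈ Finset.range n, w i ^ (p + q) := fun p => by
    induction p with
    | zero => simp
    | succ p ih =>
      intro q
      have h1 := sum_mul_le_sum_mul_of_antitone (b := fun i => a i ^ p * w i ^ q)
        (fun i j hij => mul_le_mul (pow_le_pow_left₀ (ha0 j) (ha hij) p)
          (pow_le_pow_left₀ (hw0 j) (hw hij) q) (pow_nonneg (hw0 j) q) (pow_nonneg (ha0 i) p))
        (fun i => mul_nonneg (pow_nonneg (ha0 i) p) (pow_nonneg (hw0 i) q)) h n
      calc ∑ i ∈ Finset.range n, a i ^ (p + 1) * w i ^ q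
          = ∑ i ∈ Finset.range n, a i * (a i ^ p * w i ^ q) :=
            Finset.sum_congr rfl fun i _ => by ring
        _ ≤ ∑ i ∈ Finset.range n, w i * (a i ^ p * w i ^ q) := h1
        _ = ∑ i ∈ Finset.range n, a i ^ p * w i ^ (q + 1) :=
            Finset.sum_congr rfl fun i _ => by ring
        _ ≤ ∑ i ∈ Finset.range n, w i ^ (p + (q + 1)) := ih (q + 1)
        _ = ∑ i ∈ Finset.range n, w i ^ (p + 1 + q) :=
            Finset.sum_congr rfl fun i _ => by ring
  simpa using key p 0

variable {𝕜 : Type*} [RCLike 𝕜]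

theorem decRearr_set_nonempty {x : ℕ → 𝕜} (hx : IsBddSeq x) (n : ℕ) :
    {t : ℝ | 0 ≤ t ∧ {i | t < ‖x i‖}.encard ≤ n}.Nonempty := by
  obtain ⟨C, hC⟩ := hx
  refine ⟨max C 0, le_max_right _ _, ?_⟩
  have : {i | max C 0 < ‖x i‖} = ∅ :=
    Set.eq_empty_of_forall_notMem fun i hi => absurd ((hC i).trans (le_max_left C 0)) (not_le.2 hi)
  rw [this]
  simp

theorem decRearr_antitone {x : ℕ → 𝕜} (hx : IsBddSeq x) : Antitone (decRearr x) :=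
  antitone_nat_of_succ_le fun n =>
    csInf_le_csInf ⟨0, fun _ ht => ht.1⟩ (decRearr_set_nonempty hx n) fun _ ht =>
      ⟨ht.1, ht.2.trans (by exact_mod_cast n.le_succ)⟩

theorem le_decRearr {x : ℕ → 𝕜} (hx : IsBddSeq x) {n : ℕ} {A : Finset ℕ} (hA : n < A.card) {r : ℝ}
    (h : ∀ i ∈ A, r ≤ ‖x i‖) : r ≤ decRearr x n := by
  refine le_csInf (decRearr_set_nonempty hx n) fun t ht => ?_
  by_contra! hlt
  have hsub : (A : Set ℕ) ⊆ {i | t < ‖x i‖} := fun i hi => hlt.trans_le (h i hi)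
  have h3 := (Set.encard_le_encard hsub).trans ht.2
  rw [Set.encard_coe_eq_coe_finsetCard] at h3
  exact absurd (by exact_mod_cast h3 : A.card ≤ n) (not_le.2 hA)

theorem sum_pow_le_sum_decRearr_pow {x : ℕ → 𝕜} (hx : IsBddSeq x) (p : ℕ) (A : Finset ℕ) :
    ∑ i ∈ A, ‖x i‖ ^ p ≤ ∑ i ∈ Finset.range A.card, decRearr x i ^ p := by
  induction hn : A.card generalizing A with
  | zero =>
    rw [Finset.card_eq_zero] at hn
    simp [hn]
  | succ n ih =>
    obtain ⟨a, haA, hmin⟩ := A.exists_min_image (fun i => ‖x i‖) (Finset.card_pos.1 (by omega))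
    have h1 := ih (A.erase a) (by rw [Finset.card_erase_of_mem haA]; omega)
    have h2 : ‖x a‖ ≤ decRearr x n := le_decRearr hx (by omega) hmin
    rw [← Finset.add_sum_erase A _ haA, Finset.sum_range_succ, add_comm]
    exact add_le_add h1 (pow_le_pow_left₀ (norm_nonneg _) h2 p)

end Majorization

/-! ### The diagonal power sum for `w ∈ ℓ_M` -/

namespace LorentzPredual

variable {𝕜 : Type*} [RCLike 𝕜] {w : AdmissibleSequence}

/-- The unit ball condition says exactly that the rearrangement of `x` is majorized by `w`, and
majorization passes to power sums. -/
theorem sum_norm_pow_le {M : ℕ} (hw : Summable fun i => w.toFun i ^ M) {x : LorentzPredual 𝕜 w}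
    (hx : ‖x‖ ≤ 1) (A : Finset ℕ) : ∑ i ∈ A, ‖x.seq i‖ ^ M ≤ ∑' i, w.toFun i ^ M :=
  (sum_pow_le_sum_decRearr_pow x.bdd_seq M A).trans
    ((sum_pow_le_sum_pow_of_antitone (decRearr_antitone x.bdd_seq) (decRearr_nonneg _)
      w.antitone w.nonneg (fun n => (x.rearrSum_le_norm_mul_W n).trans
        (mul_le_of_le_one_left (w.W_nonneg n) hx)) M _).trans
      (hw.sum_le_tsum _ fun i _ => pow_nonneg (w.nonneg i) M))

theorem summable_norm_pow {M : ℕ} (hw : Summable fun i => w.toFun i ^ M)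
    {x : LorentzPredual 𝕜 w} (hx : ‖x‖ ≤ 1) : Summable fun i => ‖x.seq i‖ ^ M :=
  summable_of_sum_le (fun _ => pow_nonneg (norm_nonneg _) _) (sum_norm_pow_le hw hx)

/-- The terms of the multilinear form `∑ i, (∏ j ∈ S, z j i) * ∏ j ∉ S, z j 0`. -/
noncomputable def diagTerm {ι : Type*} [Fintype ι] [DecidableEq ι] (S : Finset ι) (i : ℕ) :
    MultilinearMap 𝕜 (fun _ : ι => LorentzPredual 𝕜 w) 𝕜 :=
  (MultilinearMap.mkPiAlgebra 𝕜 ι 𝕜).compLinearMap fun j =>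
    (coord (if j ∈ S then i else 0) : LorentzPredual 𝕜 w →L[𝕜] 𝕜).toLinearMap

section DiagForm

variable {ι : Type*} [Fintype ι] [DecidableEq ι]

theorem diagTerm_apply (S : Finset ι) (i : ℕ) (z : ι → LorentzPredual 𝕜 w) :
    diagTerm S i z = ∏ j, (z j).seq (if j ∈ S then i else 0) := by
  simp [diagTerm]

/-- The product over `S` is at most a power of its largest factor, which is one term of the sum; the
remaining factors are at most `1`. -/
theorem norm_diagTerm_le {S : Finset ι} (hS : S.Nonempty) (i : ℕ) {z : ι → LorentzPredual 𝕜 w}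
    (hz : ∀ j, ‖z j‖ ≤ 1) : ‖diagTerm S i z‖ ≤ ∑ j ∈ S, ‖(z j).seq i‖ ^ S.card := by
  rw [diagTerm_apply, norm_prod, ← Finset.prod_mul_prod_compl S]
  have h1 : ∏ j ∈ Sᶜ, ‖(z j).seq (if j ∈ S then i else 0)‖ ≤ 1 :=
    Finset.prod_le_one (fun _ _ => norm_nonneg _) fun j _ => ((z j).norm_seq_le _).trans (hz j)
  refine (mul_le_of_le_one_right (Finset.prod_nonneg fun _ _ => norm_nonneg _) h1).trans ?_
  obtain ⟨k, hk, hmax⟩ := S.exists_max_image (fun j => ‖(z j).seq i‖) hS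
  calc ∏ j ∈ S, ‖(z j).seq (if j ∈ S then i else 0)‖
      ≤ ∏ _j ∈ S, ‖(z k).seq i‖ := Finset.prod_le_prod (fun _ _ => norm_nonneg _) fun j hj => by
        rw [if_pos hj]
        exact hmax j hj
    _ = ‖(z k).seq i‖ ^ S.card := by simp
    _ ≤ ∑ j ∈ S, ‖(z j).seq i‖ ^ S.card := Finset.single_le_sum
        (f := fun j => ‖(z j).seq i‖ ^ S.card) (fun _ _ => pow_nonneg (norm_nonneg _) _) hk

theorem sum_norm_diagTerm_le {S : Finset ι} (hS : S.Nonempty)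
    (hw : Summable fun i => w.toFun i ^ S.card) {z : ι → LorentzPredual 𝕜 w}
    (hz : ∀ j, ‖z j‖ ≤ 1) (A : Finset ℕ) :
    ∑ i ∈ A, ‖diagTerm S i z‖ ≤ S.card * ∑' i, w.toFun i ^ S.card := by
  refine (Finset.sum_le_sum fun i _ => norm_diagTerm_le hS i hz).trans ?_
  rw [Finset.sum_comm, ← nsmul_eq_mul]
  exact Finset.sum_le_card_nsmul _ _ _ fun j _ => sum_norm_pow_le hw (hz j) A

/-- Normalizing the arguments reduces to the unit ball. The estimate yields both absolute
convergence and continuity of the diagonal form. -/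
theorem sum_norm_diagTerm_le_prod {S : Finset ι} (hS : S.Nonempty)
    (hw : Summable fun i => w.toFun i ^ S.card) (z : ι → LorentzPredual 𝕜 w) (A : Finset ℕ) :
    ∑ i ∈ A, ‖diagTerm S i z‖ ≤ (S.card * ∑' i, w.toFun i ^ S.card) * ∏ j, ‖z j‖ := by
  by_cases hz : ∃ j, z j = 0
  · obtain ⟨j, hj⟩ := hz
    have h0 : ∀ i, diagTerm S i z = 0 := fun i => (diagTerm S i).map_coord_zero j hj
    have h1 : ∏ j, ‖z j‖ = 0 := Finset.prod_eq_zero (Finset.mem_univ j) (by simp [hj])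
    simp [h0, h1]
  · push Not at hz
    have hz' : ∀ j, ‖z j‖ ≠ 0 := fun j => norm_ne_zero_iff.2 (hz j)
    set y : ι → LorentzPredual 𝕜 w := fun j => ((‖z j‖⁻¹ : ℝ) : 𝕜) • z j with hy
    have hy1 : ∀ j, ‖y j‖ ≤ 1 := fun j => by
      simp [hy, norm_smul, hz' j]
    have hzy : z = fun j => ((‖z j‖ : ℝ) : 𝕜) • y j := by
      funext j
      rw [hy, smul_smul, ← RCLike.ofReal_mul, mul_inv_cancel₀ (hz' j), RCLike.ofReal_one, one_smul]
    have h2 : ∀ i, ‖diagTerm S i z‖ = (∏ j, ‖z j‖) * ‖diagTerm S i y‖ := fun i => by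
      conv_lhs => rw [hzy]
      rw [MultilinearMap.map_smul_univ, norm_smul, norm_prod]
      simp
    simp only [h2, ← Finset.mul_sum]
    rw [mul_comm]
    exact mul_le_mul_of_nonneg_right (sum_norm_diagTerm_le hS hw hy1 A)
      (Finset.prod_nonneg fun _ _ => norm_nonneg _)

theorem summable_norm_diagTerm {S : Finset ι} (hS : S.Nonempty)
    (hw : Summable fun i => w.toFun i ^ S.card) (z : ι → LorentzPredual 𝕜 w) :
    Summable fun i => ‖diagTerm S i z‖ :=
  summable_of_sum_le (fun _ => norm_nonneg _) (sum_norm_diagTerm_le_prod hS hw z)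

/-- The multilinear form `∑ i, (∏ j ∈ S, z j i) * ∏ j ∉ S, z j 0`. -/
noncomputable def diagMultilinear {S : Finset ι} (hS : S.Nonempty)
    (hw : Summable fun i => w.toFun i ^ S.card) :
    MultilinearMap 𝕜 (fun _ : ι => LorentzPredual 𝕜 w) 𝕜 :=
  MultilinearMap.mk' (fun z => ∑' i, diagTerm S i z)
    (fun z j x y => by
      have h1 := (summable_norm_diagTerm hS hw (Function.update z j x)).of_norm
      have h2 := (summable_norm_diagTerm hS hw (Function.update z j y)).of_norm
      rw [← h1.tsum_add h2]
      exact tsum_congr fun i => (diagTerm S i).map_update_add z j x y)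
    fun z j c x => by
      rw [smul_eq_mul, ← tsum_mul_left]
      exact tsum_congr fun i => (diagTerm S i).map_update_smul z j c x

/-- The continuous multilinear form `∑ i, (∏ j ∈ S, z j i) * ∏ j ∉ S, z j 0`. -/
noncomputable def diagForm {S : Finset ι} (hS : S.Nonempty)
    (hw : Summable fun i => w.toFun i ^ S.card) :
    ContinuousMultilinearMap 𝕜 (fun _ : ι => LorentzPredual 𝕜 w) 𝕜 :=
  (diagMultilinear hS hw).mkContinuous (S.card * ∑' i, w.toFun i ^ S.card) fun z =>
    (norm_tsum_le_tsum_norm (summable_norm_diagTerm hS hw z)).trans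
      (Real.tsum_le_of_sum_le (fun _ => norm_nonneg _) (sum_norm_diagTerm_le_prod hS hw z))

theorem diagForm_apply {S : Finset ι} (hS : S.Nonempty)
    (hw : Summable fun i => w.toFun i ^ S.card) (z : ι → LorentzPredual 𝕜 w) :
    diagForm hS hw z = ∑' i, diagTerm S i z := rfl

end DiagForm

/-- The polynomial `x ↦ x_0 ^ (N - M) * ∑ i, x_i ^ M`. -/
noncomputable def powerSum (𝕜 : Type*) [RCLike 𝕜] (w : AdmissibleSequence) (M N : ℕ)
    (x : LorentzPredual 𝕜 w) : 𝕜 :=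
  x.seq 0 ^ (N - M) * ∑' i, x.seq i ^ M

theorem powerSum_mem_homPolySubmodule {M N : ℕ} (hM : M ≠ 0) (hMN : M ≤ N)
    (hw : Summable fun i => w.toFun i ^ M) :
    powerSum 𝕜 w M N ∈ homPolySubmodule 𝕜 N (LorentzPredual 𝕜 w) 𝕜 := by
  -- Any `M` of the `N` slots will do: the choice is invisible on the diagonal.
  obtain ⟨S, -, hS⟩ := Finset.exists_subset_card_eq
    (s := (Finset.univ : Finset (Fin N))) (n := M) (by simpa using hMN)
  have hne : S.Nonempty := Finset.card_pos.1 (by omega)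
  subst hS
  refine ⟨diagForm hne hw, fun x => ?_⟩
  rw [diagForm_apply, powerSum, ← tsum_mul_left]
  refine tsum_congr fun i => ?_
  rw [diagTerm_apply, ← Finset.prod_mul_prod_compl S,
    Finset.prod_congr rfl (g := fun _ => x.seq i) fun j hj => by rw [if_pos hj],
    Finset.prod_congr (s₁ := Sᶜ) rfl (g := fun _ => x.seq 0) fun j hj => by
      rw [if_neg (Finset.mem_compl.1 hj)]]
  simp [Finset.card_compl, mul_comm]

theorem powerSum_add_smul_unit {M N : ℕ} (hw : Summable fun i => w.toFun i ^ M)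
    {x : LorentzPredual 𝕜 w} (hx : ‖x‖ ≤ 1) {n : ℕ} (hn : n ≠ 0) (c : 𝕜) :
    powerSum 𝕜 w M N (x + c • unit 𝕜 w n) =
      powerSum 𝕜 w M N x + x.seq 0 ^ (N - M) * ((x.seq n + c) ^ M - x.seq n ^ M) := by
  have hs : Summable fun i => x.seq i ^ M :=
    Summable.of_norm (by simpa only [norm_pow] using summable_norm_pow hw hx)
  have h1 := hs.hasSum.update n ((x.seq n + c) ^ M)
  have h2 : Function.update (fun i => x.seq i ^ M) n ((x.seq n + c) ^ M) =
      fun i => (x + c • unit 𝕜 w n).seq i ^ M := by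
    funext i
    by_cases hi : i = n
    · subst hi
      simp
    · simp [hi, seq_unit]
  rw [h2] at h1
  have h3 : (x + c • unit 𝕜 w n).seq 0 = x.seq 0 := by simp [seq_unit, hn.symm]
  rw [powerSum, h1.tsum_eq, h3, powerSum]
  ring

theorem powerSum_unit_zero {M N : ℕ} (hM : M ≠ 0) : powerSum 𝕜 w M N (unit 𝕜 w 0) = 1 := by
  rw [powerSum, tsum_eq_single 0 fun i hi => by simp [seq_unit, hi, hM]]
  simp

end LorentzPredual

/-! ### Coefficients of polynomials along lines -/

section LineExpansion

variable {𝕜 : Type*} [RCLike 𝕜]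

/-- The coefficients of a polynomial of degree at most `N` are bounded by its supremum on
`[0, 1]`. -/
theorem exists_coeff_bound (𝕜 : Type*) [RCLike 𝕜] (N : ℕ) :
    ∃ C : ℝ, 0 < C ∧ ∀ (a : ℕ → 𝕜) (B : ℝ),
      (∀ t : ℝ, 0 ≤ t → t ≤ 1 → ‖∑ k ∈ Finset.range (N + 1), (t : 𝕜) ^ k * a k‖ ≤ B) →
        ∀ k ≤ N, ‖a k‖ ≤ C * B := by
  -- Interpolation at `N + 1` distinct nodes of `[0, 1]`: the inverse Vandermonde matrix recovers
  -- the coefficients from the values.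
  set v : Fin (N + 1) → ℝ := fun i => (i : ℝ) / (N + 1) with hv
  have hinj : Function.Injective fun i => (v i : 𝕜) := fun i j hij => by
    have h1 := RCLike.ofReal_injective hij
    have h2 : (N : ℝ) + 1 ≠ 0 := by positivity
    simpa [hv, h2, div_left_inj', Fin.val_inj] using h1
  set V : Matrix (Fin (N + 1)) (Fin (N + 1)) 𝕜 := Matrix.vandermonde fun i => (v i : 𝕜) with hV
  have hdet : IsUnit V.det := isUnit_iff_ne_zero.2 (Matrix.det_vandermonde_ne_zero_iff.2 hinj)
  refine ⟨∑ k, ∑ i, ‖V⁻¹ k i‖ + 1, by positivity, fun a B hB k hk => ?_⟩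
  have hB0 : 0 ≤ B := (norm_nonneg _).trans (hB 0 le_rfl zero_le_one)
  set q : Fin (N + 1) → 𝕜 := V.mulVec fun i => a i with hq
  have hqB : ∀ i, ‖q i‖ ≤ B := fun i => by
    have h := hB (v i) (by positivity) (by
      rw [hv, div_le_one (by positivity)]
      exact_mod_cast i.2.le)
    rwa [Finset.sum_range fun k => (v i : 𝕜) ^ k * a k] at h
  have ha : a k = ∑ i, V⁻¹ ⟨k, by omega⟩ i * q i := by
    have h1 : V⁻¹.mulVec q = fun i : Fin (N + 1) => a i := by
      rw [hq, Matrix.mulVec_mulVec, Matrix.nonsing_inv_mul _ hdet, Matrix.one_mulVec]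
    exact (congrFun h1 ⟨k, by omega⟩).symm
  calc ‖a k‖ ≤ ∑ i, ‖V⁻¹ ⟨k, by omega⟩ i‖ * B := by
        rw [ha]
        refine norm_sum_le_of_le _ fun i _ => ?_
        rw [norm_mul]
        exact mul_le_mul_of_nonneg_left (hqB i) (norm_nonneg _)
    _ = (∑ i, ‖V⁻¹ ⟨k, by omega⟩ i‖) * B := by rw [Finset.sum_mul]
    _ ≤ (∑ k, ∑ i, ‖V⁻¹ k i‖ + 1) * B := by
        refine mul_le_mul_of_nonneg_right ?_ hB0
        have := Finset.single_le_sum (f := fun k => ∑ i, ‖V⁻¹ k i‖)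
          (fun _ _ => Finset.sum_nonneg fun _ _ => norm_nonneg _)
          (Finset.mem_univ (⟨k, by omega⟩ : Fin (N + 1)))
        linarith

variable {X : Type*} [NormedAddCommGroup X] [NormedSpace 𝕜 X]

/-- The coefficient of `c ^ k` in the polynomial `c ↦ ∑ j ≤ N, Φ j (x + c y, …, x + c y)`. -/
noncomputable def lineCoeff (Φ : ∀ j : ℕ, ContinuousMultilinearMap 𝕜 (fun _ : Fin j => X) 𝕜)
    (N k : ℕ) (x y : X) : 𝕜 :=
  ∑ j ∈ Finset.range (N + 1), ∑ s : Finset (Fin j) with sᶜ.card = k,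
    Φ j (s.piecewise (fun _ => x) fun _ => y)

/-- Multilinear expansion, grouped by the number of slots filled with `y`. -/
theorem sum_form_add_smul_eq (Φ : ∀ j : ℕ, ContinuousMultilinearMap 𝕜 (fun _ : Fin j => X) 𝕜)
    (N : ℕ) (x y : X) (c : 𝕜) :
    ∑ j ∈ Finset.range (N + 1), (Φ j fun _ => x + c • y) =
      ∑ k ∈ Finset.range (N + 1), c ^ k * lineCoeff Φ N k x y := by
  simp only [lineCoeff, Finset.mul_sum]
  rw [Finset.sum_comm]
  refine Finset.sum_congr rfl fun j hj => ?_
  have h1 : (fun _ : Fin j => x + c • y) = (fun _ => x) + fun _ => c • y := rfl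
  have h2 : ∀ s : Finset (Fin j), Φ j (s.piecewise (fun _ => x) fun _ => c • y) =
      c ^ sᶜ.card * Φ j (s.piecewise (fun _ => x) fun _ => y) := fun s => by
    have h3 : s.piecewise (fun _ => x) (fun _ => c • y) = sᶜ.piecewise
        (fun i => c • s.piecewise (fun _ => x) (fun _ => y) i)
        (s.piecewise (fun _ => x) fun _ => y) := by
      funext i
      by_cases hi : i ∈ s <;> simp [hi]
    rw [h3, (Φ j).map_piecewise_smul (fun _ => c)]
    simp
  rw [h1, (Φ j).map_add_univ]
  simp only [h2]
  rw [← Finset.sum_fiberwise_of_maps_to (s := Finset.univ) (t := Finset.range (N + 1))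
    (g := fun s : Finset (Fin j) => sᶜ.card)]
  · refine Finset.sum_congr rfl fun k _ => Finset.sum_congr rfl fun s hs => ?_
    rw [(Finset.mem_filter.1 hs).2]
  · intro s _
    have h4 : sᶜ.card ≤ j := by simpa using Finset.card_le_univ sᶜ
    rw [Finset.mem_range] at hj ⊢
    omega

/-- The line coefficients of a polynomial are bounded by its norm. -/
theorem exists_lineCoeff_bound (𝕜 : Type*) [RCLike 𝕜] (X : Type*) [NormedAddCommGroup X]
    [NormedSpace 𝕜 X] (N : ℕ) :
    ∃ C : ℝ, 0 < C ∧
      ∀ (Φ : ∀ j : ℕ, ContinuousMultilinearMap 𝕜 (fun _ : Fin j => X) 𝕜) (η : ℝ),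
      (∀ x, ‖x‖ ≤ 1 → ‖∑ j ∈ Finset.range (N + 1), (Φ j fun _ => x)‖ ≤ η) →
        ∀ x y, ‖x‖ ≤ 1 → ‖y‖ ≤ 1 → ∀ k ≤ N, ‖lineCoeff Φ N k x y‖ ≤ C * η := by
  obtain ⟨C, hC0, hC⟩ := exists_coeff_bound 𝕜 N
  -- The segment `x + t y` leaves the unit ball but not the ball of radius `2`. There each of the `N
  -- + 1` homogeneous parts, bounded by `C * η` on the unit ball, grows by at most `2 ^ N`; the
  -- outer `C` comes from interpolating along the segment.
  refine ⟨C * ((N + 1) * (2 ^ N * C)), by positivity, fun Φ η hη => ?_⟩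
  have hη0 : 0 ≤ η := (norm_nonneg _).trans (hη 0 (by simp))
  have hsmul : ∀ (c : 𝕜) (u : X) (j : ℕ), (Φ j fun _ => c • u) = c ^ j * Φ j fun _ => u :=
    fun c u j => by simpa using (Φ j).map_smul_univ (fun _ => c) fun _ => u
  have h2 : ∀ u, ‖u‖ ≤ 2 → ‖∑ j ∈ Finset.range (N + 1), (Φ j fun _ => u)‖ ≤
      (N + 1) * (2 ^ N * C) * η := fun u hu => by
    set u' : X := (2⁻¹ : 𝕜) • u with hu'
    have hu'1 : ‖u'‖ ≤ 1 := by
      rw [hu', norm_smul, norm_inv, RCLike.norm_ofNat]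
      linarith
    have huu : u = (2 : 𝕜) • u' := by rw [hu', smul_smul]; simp
    have hcoef := hC (fun j => Φ j fun _ => u') η fun t ht0 ht1 => by
      simp only [← hsmul]
      refine hη _ ?_
      rw [norm_smul, RCLike.norm_ofReal, abs_of_nonneg ht0]
      exact mul_le_one₀ ht1 (norm_nonneg _) hu'1
    refine (norm_sum_le_of_le (n := fun _ => 2 ^ N * C * η) _ fun j hj => ?_).trans ?_
    · have hjN : j ≤ N := by simpa [Nat.lt_succ_iff] using hj
      rw [huu, hsmul, norm_mul, norm_pow, RCLike.norm_ofNat, mul_assoc]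
      exact mul_le_mul (pow_le_pow_right₀ one_le_two hjN) (hcoef j hjN) (norm_nonneg _)
        (by positivity)
    · rw [Finset.sum_const, Finset.card_range, nsmul_eq_mul]
      push_cast
      exact le_of_eq (by ring)
  intro x y hx hy k hk
  rw [mul_assoc]
  refine hC (fun k => lineCoeff Φ N k x y) _ (fun t ht0 ht1 => ?_) k hk
  rw [← sum_form_add_smul_eq]
  refine h2 _ ((norm_add_le _ _).trans ?_)
  rw [norm_smul, RCLike.norm_ofReal, abs_of_nonneg ht0]
  have := mul_le_one₀ ht1 (norm_nonneg _) hy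
  linarith

end LineExpansion

/-! ### The choice of phase -/

section Phase

variable {𝕜 : Type*} [RCLike 𝕜]

theorem exists_pow_eq_of_im_I_eq_one (h : RCLike.im (RCLike.I : 𝕜) = 1) {M : ℕ} (hM : M ≠ 0)
    (u : 𝕜) : ∃ ζ : 𝕜, ζ ^ M = u := by
  obtain ⟨z, hz⟩ := IsAlgClosed.exists_pow_nat_eq
    (RCLike.complexRingEquiv h u) (Nat.pos_of_ne_zero hM)
  refine ⟨(RCLike.complexRingEquiv h).symm z, ?_⟩
  rw [← map_pow, hz, RingEquiv.symm_apply_apply]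

theorem eq_ofReal_re_of_I_eq_zero (h : (RCLike.I : 𝕜) = 0) (z : 𝕜) : (RCLike.re z : 𝕜) = z := by
  have := RCLike.re_add_im z
  rwa [h, mul_zero, add_zero] at this

/-- A number of the form `∑ x_i ^ M * θ` can be increased in modulus, at the maximal rate, in
the direction of `θ * ζ ^ M` for some unimodular `ζ`; this persists for the numbers `a` close to
it. -/
theorem exists_phase {M : ℕ} (hM : M ≠ 0) {x : ℕ → 𝕜} (θ a : 𝕜)
    (ha : ‖a - θ * ∑' i, x i ^ M‖ < ‖a‖) :
    ∃ ζ : 𝕜, ‖ζ‖ = 1 ∧ ∀ t : ℝ, 0 ≤ t → ‖a + θ * ((t : 𝕜) * ζ) ^ M‖ = ‖a‖ + ‖θ‖ * t ^ M := by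
  by_cases hθ : θ = 0
  · exact ⟨1, by simp, by simp [hθ]⟩
  have ha0 : a ≠ 0 := by
    rintro rfl
    rw [norm_zero] at ha
    exact absurd ha (not_lt.2 (norm_nonneg _))
  have hna : ‖a‖ ≠ 0 := norm_ne_zero_iff.2 ha0
  have hnθ : ‖θ‖ ≠ 0 := norm_ne_zero_iff.2 hθ
  have hna' : (‖a‖ : 𝕜) ≠ 0 := by exact_mod_cast hna
  have hnθ' : (‖θ‖ : 𝕜) ≠ 0 := by exact_mod_cast hnθ
  -- The unimodular number for which `θ * u` is a positive multiple of `a`; it has to be an `M`-th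
  -- power.
  set u : 𝕜 := ‖θ‖ * a / (‖a‖ * θ) with hu
  have hu1 : ‖u‖ = 1 := by
    rw [hu, norm_div, norm_mul, norm_mul, RCLike.norm_ofReal, RCLike.norm_ofReal, abs_norm,
      abs_norm]
    field_simp
  obtain ⟨ζ, hζ⟩ : ∃ ζ : 𝕜, ζ ^ M = u := by
    rcases RCLike.I_eq_zero_or_im_I_eq_one (K := 𝕜) with hI | hI
    · have hreal := eq_ofReal_re_of_I_eq_zero hI
      have hu2 : u = 1 ∨ u = -1 := by
        rw [← hreal u] at hu1 ⊢
        rw [RCLike.norm_ofReal] at hu1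
        rcases eq_or_eq_neg_of_abs_eq hu1 with h | h <;> rw [h] <;> simp
      rcases hu2 with h | h
      · exact ⟨1, by simp [h]⟩
      · rcases Nat.even_or_odd M with hev | hodd
        -- Real scalars, `M` even, `u = -1`: then `a` and `θ` have opposite signs. As the power sum
        -- is nonnegative, `θ * ∑ x_i ^ M` lies at distance at least `‖a‖` from `a`, against `ha`.
        · exfalso
          set s : ℝ := ∑' i, (RCLike.re (x i)) ^ M with hs
          have hs0 : 0 ≤ s := tsum_nonneg fun i => hev.pow_nonneg _
          have hsx : ∑' i, x i ^ M = (s : 𝕜) := by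
            rw [hs, RCLike.ofReal_tsum]
            refine tsum_congr fun i => ?_
            rw [RCLike.ofReal_pow, hreal]
          have haθ : a = -(((‖a‖ / ‖θ‖ : ℝ) : 𝕜) * θ) := by
            rw [hu, div_eq_iff (by positivity)] at h
            push_cast
            field_simp
            linear_combination h
          have h3 : a - θ * ∑' i, x i ^ M = -((((‖a‖ / ‖θ‖ + s : ℝ)) : 𝕜) * θ) := by
            rw [hsx]
            conv_lhs => rw [haθ]
            push_cast
            ring
          rw [h3, norm_neg, norm_mul, RCLike.norm_ofReal, abs_of_nonneg (by positivity),
            add_mul, div_mul_cancel₀ _ hnθ] at ha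
          have := mul_nonneg hs0 (norm_nonneg θ)
          linarith
        · exact ⟨-1, by rw [hodd.neg_one_pow, h]⟩
    · exact exists_pow_eq_of_im_I_eq_one hI hM u
  refine ⟨ζ, ?_, fun t ht => ?_⟩
  · rw [← hζ, norm_pow] at hu1
    exact (pow_eq_one_iff_of_nonneg (norm_nonneg _) hM).1 hu1
  · have h4 : a + θ * ((t : 𝕜) * ζ) ^ M = a * ((1 + t ^ M * ‖θ‖ / ‖a‖ : ℝ) : 𝕜) := by
      rw [mul_pow, hζ, hu]
      push_cast
      field_simp
    rw [h4, norm_mul, RCLike.norm_ofReal, abs_of_nonneg (by positivity)]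
    field_simp

end Phase

/-! ### Failure of density when `w ∈ ℓ_N` -/

namespace LorentzPredual

variable {𝕜 : Type*} [RCLike 𝕜] {w : AdmissibleSequence}

/-- If `w ∉ ℓ_K`, the coefficients of order at most `K` of a polynomial along the lines in the
directions of the basis vectors tend to zero. -/
theorem tendsto_lineCoeff {K : ℕ} (hw : ¬ Summable fun i => w.toFun i ^ K)
    (Φ : ∀ j : ℕ, ContinuousMultilinearMap 𝕜 (fun _ : Fin j => LorentzPredual 𝕜 w) 𝕜) (N : ℕ)
    {k : ℕ} (hk0 : k ≠ 0) (hk : k ≤ K) (x : LorentzPredual 𝕜 w) :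
    Tendsto (fun n => lineCoeff Φ N k x (unit 𝕜 w n)) atTop (𝓝 0) := by
  unfold lineCoeff
  rw [show (0 : 𝕜) = ∑ j ∈ Finset.range (N + 1),
    ∑ s : Finset (Fin j) with sᶜ.card = k, (0 : 𝕜) by simp]
  refine tendsto_finsetSum _ fun j _ => tendsto_finsetSum _ fun s hs => ?_
  have hs : sᶜ.card = k := (Finset.mem_filter.1 hs).2
  rw [tendsto_zero_iff_norm_tendsto_zero, Metric.tendsto_atTop]
  intro ε hε
  obtain ⟨i, hi⟩ : sᶜ.Nonempty := Finset.card_pos.1 (by omega)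
  obtain ⟨m, hm⟩ := (vanishes_of_not_summable (T := sᶜ) (hs.trans_le hk) hw (Φ j)
    (s.piecewise (fun _ => ArgKind.fixed x) fun _ => .basis)
    (fun i hi => by
      have : i ∈ s := by simpa using hi
      simp [this, ArgKind.weight])
    ⟨i, by
      have : i ∉ s := by simpa using hi
      simp [this, ArgKind.Moving]⟩ (ε / 2) (half_pos hε)).exists
  refine ⟨m, fun n hn => ?_⟩
  rw [dist_zero_right, norm_norm]
  refine (hm _ fun i => ?_).trans_lt (half_lt_self hε)
  by_cases hi : i ∈ s
  · simp only [hi, Finset.piecewise_eq_of_mem]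
    rfl
  · simp only [hi, not_false_eq_true, Finset.piecewise_eq_of_notMem]
    exact ⟨1, n, by simp, hn, by simp⟩

/-- No small perturbation of `powerSum` of degree at most `N` attains its norm, when `M` is the
smallest exponent with `w ∈ ℓ_M`. -/
theorem exists_powerSum_not_attaining {M N : ℕ} (hM : 2 ≤ M) (hMN : M ≤ N)
    (hw : Summable fun i => w.toFun i ^ M) (hw' : ¬ Summable fun i => w.toFun i ^ (M - 1)) :
    ∃ η : ℝ, 0 < η ∧ η ≤ 1 / 4 ∧ ∀ R ∈ polySubmodule 𝕜 N (LorentzPredual 𝕜 w) 𝕜,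
      (∀ x : LorentzPredual 𝕜 w, ‖x‖ ≤ 1 → ‖R x‖ ≤ η) →
      ∀ x₀ : LorentzPredual 𝕜 w, ‖x₀‖ ≤ 1 → ∃ x : LorentzPredual 𝕜 w, ‖x‖ ≤ 1 ∧
        ‖powerSum 𝕜 w M N x₀ + R x₀‖ < ‖powerSum 𝕜 w M N x + R x‖ := by
  obtain ⟨C, hC0, hC⟩ := exists_lineCoeff_bound 𝕜 (LorentzPredual 𝕜 w) N
  set K : ℝ := ∑' i, w.toFun i ^ M with hK
  have hK1 : 1 ≤ K := by
    have h := hw.le_tsum 0 fun i _ => pow_nonneg (w.nonneg i) M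
    simpa [w.zero_eq_one] using h
  -- The bound `1 / 4` keeps the maximum away from zero, which forces `‖θ‖ ≥ 1 / (2 * K)`. The other
  -- bound makes all coefficients of `R` of order at least `M` together at most half of `‖θ‖`.
  have hη0 : 0 < min (1 / 4) (1 / (4 * K * ((N + 1) * C))) := by positivity
  refine ⟨min (1 / 4) (1 / (4 * K * ((N + 1) * C))), hη0, min_le_left _ _, ?_⟩
  have hη4 := min_le_left (1 / 4 : ℝ) (1 / (4 * K * ((N + 1) * C)))
  have hηC := min_le_right (1 / 4 : ℝ) (1 / (4 * K * ((N + 1) * C)))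
  generalize min (1 / 4 : ℝ) (1 / (4 * K * ((N + 1) * C))) = η at hη0 hη4 hηC
  rintro R ⟨P, hP, hR⟩ hRη x₀ hx₀
  by_contra! hmax
  choose Φ hΦ using hP
  have hRΦ : ∀ x, R x = ∑ j ∈ Finset.range (N + 1), (Φ j fun _ => x) := fun x => by
    simp only [hR, hΦ]
  set a := powerSum 𝕜 w M N x₀ + R x₀ with ha
  set θ := x₀.seq 0 ^ (N - M) with hθ
  have hpx₀ : powerSum 𝕜 w M N x₀ = θ * ∑' i, x₀.seq i ^ M := rfl
  have hunit := hmax (unit 𝕜 w 0) (norm_unit_le 0)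
  rw [powerSum_unit_zero (by omega)] at hunit
  have h1 : 1 - η ≤ ‖(1 : 𝕜) + R (unit 𝕜 w 0)‖ := by
    have h := norm_sub_le_norm_add (1 : 𝕜) (R (unit 𝕜 w 0))
    rw [norm_one] at h
    linarith [hRη _ (norm_unit_le (𝕜 := 𝕜) (w := w) 0)]
  have hnear : ‖a - θ * ∑' i, x₀.seq i ^ M‖ ≤ η := by
    rw [← hpx₀, ha, add_sub_cancel_left]
    exact hRη x₀ hx₀
  have hθK : 1 / (2 * K) ≤ ‖θ‖ := by
    have h2 : ‖∑' i, x₀.seq i ^ M‖ ≤ K := by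
      have hs := summable_norm_pow hw hx₀
      have hs' : Summable fun i => ‖x₀.seq i ^ M‖ := by simpa only [norm_pow] using hs
      refine (norm_tsum_le_tsum_norm hs').trans ?_
      simp only [norm_pow]
      exact Real.tsum_le_of_sum_le (fun _ => pow_nonneg (norm_nonneg _) _) (sum_norm_pow_le hw hx₀)
    have h3 := norm_sub_norm_le a (θ * ∑' i, x₀.seq i ^ M)
    rw [norm_mul] at h3
    rw [div_le_iff₀ (by positivity)]
    nlinarith [mul_le_mul_of_nonneg_left h2 (norm_nonneg θ)]
  have hηθ : (N + 1) * (C * η) ≤ ‖θ‖ / 2 := by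
    rw [le_div_iff₀ (by positivity)] at hηC
    have h4 : (N + 1) * (C * η) ≤ 1 / (4 * K) := by
      rw [le_div_iff₀ (by positivity)]
      linarith
    have h5 : 1 / (4 * K) = 1 / (2 * K) / 2 := by
      field_simp
      norm_num
    linarith
  have hθ0 : 0 < ‖θ‖ := lt_of_lt_of_le (by positivity) hθK
  obtain ⟨ζ, hζ, hphase⟩ := exists_phase (by omega : M ≠ 0) θ a
    (hnear.trans_lt (by linarith : η < ‖a‖))
  obtain ⟨δ, hδ, n₀, hball⟩ := exists_forall_norm_add_smul_unit_le_one hx₀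
  -- `t ≤ δ` keeps the perturbed vector in the ball; `t ≤ 1` gives `t ^ k ≤ t ^ M` for `k ≥ M`.
  set t : ℝ := min δ 1 with ht
  have ht0 : 0 < t := by positivity
  have ht1 : t ≤ 1 := min_le_right _ _
  set c : 𝕜 := (t : 𝕜) * ζ with hc
  have hcn : ‖c‖ = t := by rw [hc, norm_mul, hζ, RCLike.norm_ofReal, abs_of_pos ht0, mul_one]
  -- Everything that disappears as `n → ∞`: the cross terms with `x₀(n)`, and the coefficients of
  -- `R` of orders `1, …, M - 1`, which is where `w ∉ ℓ_{M-1}` enters.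
  set E : ℕ → 𝕜 := fun n => θ * ((x₀.seq n + c) ^ M - x₀.seq n ^ M - c ^ M) +
    ∑ k ∈ Finset.Ico 1 M, c ^ k * lineCoeff Φ N k x₀ (unit 𝕜 w n) with hE
  have hE0 : Tendsto E atTop (𝓝 0) := by
    have h6 : Tendsto (fun n => θ * ((x₀.seq n + c) ^ M - x₀.seq n ^ M - c ^ M)) atTop
        (𝓝 (θ * ((0 + c) ^ M - 0 ^ M - c ^ M))) :=
      ((((x₀.tendsto_seq.add_const c).pow M).sub (x₀.tendsto_seq.pow M)).sub_const _).const_mul θ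
    have h7 : Tendsto (fun n => ∑ k ∈ Finset.Ico 1 M, c ^ k * lineCoeff Φ N k x₀ (unit 𝕜 w n))
        atTop (𝓝 (∑ k ∈ Finset.Ico 1 M, c ^ k * 0)) :=
      tendsto_finsetSum _ fun k hk => by
        rw [Finset.mem_Ico] at hk
        exact (tendsto_lineCoeff hw' Φ N (by omega) (by omega) x₀).const_mul _
    have h8 := h6.add h7
    rw [zero_add, zero_pow (by omega : M ≠ 0), sub_zero, sub_self, mul_zero, zero_add] at h8
    simpa using h8
  have htM : 0 < ‖θ‖ * t ^ M / 2 := by positivity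
  obtain ⟨n, hEn, hn₀, hn1⟩ := ((hE0.norm.eventually (gt_mem_nhds ((norm_zero (E := 𝕜)).trans_lt
    htM))).and ((eventually_ge_atTop n₀).and (eventually_ge_atTop 1))).exists
  have hle := hmax _ (hball n hn₀ c (hcn.trans_le (min_le_left _ _)))
  have hexp : powerSum 𝕜 w M N (x₀ + c • unit 𝕜 w n) + R (x₀ + c • unit 𝕜 w n) =
      (a + θ * c ^ M) + (E n +
        ∑ k ∈ Finset.Ico M (N + 1), c ^ k * lineCoeff Φ N k x₀ (unit 𝕜 w n)) := by
    have h9 : R x₀ = lineCoeff Φ N 0 x₀ (unit 𝕜 w n) := by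
      have h := sum_form_add_smul_eq Φ N x₀ (unit 𝕜 w n) 0
      simp only [zero_smul, add_zero, ← hRΦ] at h
      rw [h, Finset.sum_eq_single 0 (fun k _ hk => by simp [hk]) (by simp)]
      simp
    have h10 : R (x₀ + c • unit 𝕜 w n) = R x₀ +
        (∑ k ∈ Finset.Ico 1 M, c ^ k * lineCoeff Φ N k x₀ (unit 𝕜 w n) +
          ∑ k ∈ Finset.Ico M (N + 1), c ^ k * lineCoeff Φ N k x₀ (unit 𝕜 w n)) := by
      rw [Finset.sum_Ico_consecutive _ (by omega) (by omega), hRΦ (x₀ + c • unit 𝕜 w n),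
        sum_form_add_smul_eq, Finset.range_eq_Ico, Finset.sum_eq_sum_Ico_succ_bot (by omega), h9]
      simp
    rw [h10, powerSum_add_smul_unit hw hx₀ (by omega), ha, hE]
    ring
  have hrest : ‖∑ k ∈ Finset.Ico M (N + 1), c ^ k * lineCoeff Φ N k x₀ (unit 𝕜 w n)‖ ≤
      ‖θ‖ * t ^ M / 2 := by
    refine (norm_sum_le_of_le (n := fun _ => t ^ M * (C * η)) _ fun k hk => ?_).trans ?_
    · rw [Finset.mem_Ico] at hk
      rw [norm_mul, norm_pow, hcn]
      exact mul_le_mul (pow_le_pow_of_le_one ht0.le ht1 hk.1)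
        (hC Φ η (fun x hx => by rw [← hRΦ]; exact hRη x hx) x₀ _ hx₀ (norm_unit_le n) k (by omega))
        (norm_nonneg _) (by positivity)
    · rw [Finset.sum_const, nsmul_eq_mul, Nat.card_Ico]
      have h11 : ((N + 1 - M : ℕ) : ℝ) ≤ N + 1 := by exact_mod_cast Nat.sub_le _ _
      calc ((N + 1 - M : ℕ) : ℝ) * (t ^ M * (C * η)) ≤ (N + 1) * (t ^ M * (C * η)) :=
            mul_le_mul_of_nonneg_right h11 (by positivity)
        _ = t ^ M * ((N + 1) * (C * η)) := by ring
        _ ≤ t ^ M * (‖θ‖ / 2) := mul_le_mul_of_nonneg_left hηθ (by positivity)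
        _ = ‖θ‖ * t ^ M / 2 := by ring
  rw [hexp] at hle
  have h12 := norm_sub_le_norm_add (a + θ * c ^ M)
    (E n + ∑ k ∈ Finset.Ico M (N + 1), c ^ k * lineCoeff Φ N k x₀ (unit 𝕜 w n))
  have h13 := norm_add_le (E n)
    (∑ k ∈ Finset.Ico M (N + 1), c ^ k * lineCoeff Φ N k x₀ (unit 𝕜 w n))
  have h14 := hphase t ht0.le
  rw [← hc] at h14
  linarith

/-- If `w ∈ ℓ_N`, there is a `c₀`-valued `N`-homogeneous polynomial with a neighbourhood, among the
polynomials of degree at most `N`, without norm attaining elements. -/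
theorem exists_homPoly_not_attaining {N : ℕ} (hw : Summable fun i => w.toFun i ^ N) :
    ∃ p ∈ homPolySubmodule 𝕜 N (LorentzPredual 𝕜 w) C₀(ℕ, 𝕜), ∃ η : ℝ, 0 < η ∧
      ∀ f ∈ polySubmodule 𝕜 N (LorentzPredual 𝕜 w) C₀(ℕ, 𝕜), ballNorm (f - p) < η →
        ∀ x₀ : LorentzPredual 𝕜 w, ‖x₀‖ ≤ 1 → ‖f x₀‖ ≠ ballNorm f := by
  classical
  have hex : ∃ M, Summable fun i => w.toFun i ^ M := ⟨N, hw⟩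
  -- Minimality of `M` supplies `w ∉ ℓ_{M-1}`; divergence of `∑ w` gives `M ≥ 2`.
  obtain ⟨M, hwM, hmin⟩ : ∃ M, (Summable fun i => w.toFun i ^ M) ∧
      ∀ m < M, ¬ Summable fun i => w.toFun i ^ m :=
    ⟨Nat.find hex, Nat.find_spec hex, fun m hm => Nat.find_min hex hm⟩
  have hMN : M ≤ N := by
    by_contra! hlt
    exact hmin N hlt hw
  have hM : 2 ≤ M := by
    by_contra! hlt
    refine w.not_summable ?_
    have := w.summable_pow_of_le (by omega : M ≤ 1) hwM
    simpa using this
  obtain ⟨η, hη0, hη4, hη⟩ := exists_powerSum_not_attaining (𝕜 := 𝕜) hM hMN hwM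
    (hmin (M - 1) (by omega))
  have hp := powerSum_mem_homPolySubmodule (𝕜 := 𝕜) (by omega) hMN hwM
  have hp' := comp_mem_homPolySubmodule (nullSeqSingle 𝕜 0) hp
  refine ⟨_, hp', η, hη0, fun f hf hfη x₀ hx₀ hatt => ?_⟩
  have hsub := Submodule.sub_mem _ hf (homPolySubmodule_le hp')
  have hclose : ∀ x : LorentzPredual 𝕜 w, ‖x‖ ≤ 1 →
      ‖f x - nullSeqSingle 𝕜 0 (powerSum 𝕜 w M N x)‖ ≤ η := fun x hx =>
    (norm_le_ballNorm hsub hx).trans hfη.le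
  have hbound : ∀ x : LorentzPredual 𝕜 w, ‖x‖ ≤ 1 → ‖f x 0‖ ≤ ‖f x₀‖ := fun x hx =>
    ((f x).norm_apply_le 0).trans ((norm_le_ballNorm hf hx).trans hatt.ge)
  obtain ⟨x, hx, hlt⟩ := hη (fun x => f x 0 - powerSum 𝕜 w M N x)
    (Submodule.sub_mem _ (comp_mem_polySubmodule (nullSeqCoord 𝕜 0) hf) (homPolySubmodule_le hp))
    (fun x hx => by
      have h := (ZeroAtInftyContinuousMap.norm_apply_le _ 0).trans (hclose x hx)
      simpa [nullSeqSingle_apply] using h) x₀ hx₀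
  simp only [add_sub_cancel] at hlt
  have hlarge : 3 / 4 ≤ ‖f x₀‖ := by
    refine le_trans ?_ (hbound _ (norm_unit_le 0))
    have h := (ZeroAtInftyContinuousMap.norm_apply_le _ 0).trans
      (hclose _ (norm_unit_le (𝕜 := 𝕜) (w := w) 0))
    rw [ZeroAtInftyContinuousMap.sub_apply, nullSeqSingle_apply, if_pos rfl,
      powerSum_unit_zero (by omega)] at h
    have h' := norm_sub_norm_le (1 : 𝕜) (f (unit 𝕜 w 0) 0)
    rw [norm_sub_rev, norm_one] at h'
    linarith
  -- Coordinates other than `0` come from the perturbation alone and are at most `η ≤ 1 / 4 < 3 /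
  -- 4`, so the norm would have to be attained in coordinate `0`, where it is not.
  have hcoord : ‖f x₀‖ ≤ max ‖f x₀ 0‖ η :=
    ZeroAtInftyContinuousMap.norm_le_of_forall fun i => by
      by_cases hi : i = 0
      · rw [hi]
        exact le_max_left _ _
      · have h := (ZeroAtInftyContinuousMap.norm_apply_le _ i).trans (hclose x₀ hx₀)
        rw [ZeroAtInftyContinuousMap.sub_apply, nullSeqSingle_apply, if_neg hi, sub_zero] at h
        exact h.trans (le_max_right _ _)
  exact absurd hcoord (not_le.2 (max_lt (hlt.trans_le (hbound x hx)) (by linarith)))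

theorem not_dense_normAttaining_homPoly {N : ℕ} (hw : Summable fun i => w.toFun i ^ N) :
    ¬ Dense (HomPoly.normAttaining 𝕜 N (LorentzPredual 𝕜 w) C₀(ℕ, 𝕜)) := fun hd => by
  obtain ⟨p, hp, η, hη0, hη⟩ := exists_homPoly_not_attaining (𝕜 := 𝕜) hw
  let P : HomPoly 𝕜 N (LorentzPredual 𝕜 w) C₀(ℕ, 𝕜) := ⟨p, hp⟩
  obtain ⟨Q, hQ, x₀, hx₀, hatt⟩ := Metric.dense_iff.1 hd P η hη0
  rw [Metric.mem_ball, dist_eq_norm] at hQ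
  exact hη Q Q.mem_poly hQ x₀ hx₀ hatt

theorem not_dense_normAttaining_polyDegLE {N : ℕ} (hw : Summable fun i => w.toFun i ^ N) :
    ¬ Dense (PolyDegLE.normAttaining 𝕜 N (LorentzPredual 𝕜 w) C₀(ℕ, 𝕜)) := fun hd => by
  obtain ⟨p, hp, η, hη0, hη⟩ := exists_homPoly_not_attaining (𝕜 := 𝕜) hw
  let P : PolyDegLE 𝕜 N (LorentzPredual 𝕜 w) C₀(ℕ, 𝕜) := ⟨p, homPolySubmodule_le hp⟩
  obtain ⟨Q, hQ, x₀, hx₀, hatt⟩ := Metric.dense_iff.1 hd P η hη0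
  rw [Metric.mem_ball, dist_eq_norm] at hQ
  exact hη Q Q.2 hQ x₀ hx₀ hatt

end LorentzPredual

theorem mainTheorem8 (𝕜 : Type*) [RCLike 𝕜] (w : AdmissibleSequence) (N : ℕ) (hN : 2 ≤ N) :
    (Dense (HomPoly.normAttaining 𝕜 N (LorentzPredual 𝕜 w) C₀(ℕ, 𝕜)) ↔
      ¬ Memℓp w.toFun (N : ENNReal)) ∧
    (Dense (PolyDegLE.normAttaining 𝕜 N (LorentzPredual 𝕜 w) C₀(ℕ, 𝕜)) ↔
      ¬ Memℓp w.toFun (N : ENNReal)) := by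
  rw [w.memℓp_iff (by omega)]
  exact ⟨⟨fun hd hw => LorentzPredual.not_dense_normAttaining_homPoly hw hd,
      LorentzPredual.dense_normAttaining_homPoly⟩,
    ⟨fun hd hw => LorentzPredual.not_dense_normAttaining_polyDegLE hw hd,
      LorentzPredual.dense_normAttaining_polyDegLE⟩⟩
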